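/- Let $\Psi$ be a set, $F$ a field and $k\subsetneq F$ a subfield algebraically closed in $F$ (every element of $F$ algebraic over $k$ lies in $k$). Let $\mathfrak S_\Psi$ be the group of all permutations of $\Psi$, with the topology generated by the translates of the stabilizers of the elements of $\Psi$. Let $\bigotimes_{k,\,i\in\Psi}F$ be the coproduct, in the category of commutative $k$-algebras, of copies of $F$ labeled by $\Psi$; if $k$ is not perfect, assume that this algebra is an integral domain. (If $k$ is perfect, it is automatically an integral domain.) Let $F_\Psi$ be its field of fractions, on which $\mathfrak S_\Psi$ acts by permuting the tensor factors. For a field $K$ with an action of $\mathfrak S_\Psi$ by field automorphisms, a smooth $K$-semilinear representation of $\mathfrak S_\Psi$ is a $K$-vector space $V$ with an additive action of $\mathfrak S_\Psi$ such that $\sigma(av)=\sigma(a)\sigma(v)$ for all $\sigma\in\mathfrak S_\Psi$, $a\in K$, $v\in V$, and such that the stabilizer of every $v\in V$ is open; $\mathrm{Sm}_K(\mathfrak S_\Psi)$ denotes the category of these representations and of their $K$-linear $\mathfrak S_\Psi$-equivariant maps. Let $K\subseteq F_\Psi$ be any $\mathfrak S_\Psi$-invariant subfield. Then $F_\Psi$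 is an injective object and a cogenerator of $\mathrm{Sm}_K(\mathfrak S_\Psi)$. In particular: (i) every smooth $K$-semilinear representation of $\mathfrak S_\Psi$ embeds, $K$-linearly and $\mathfrak S_\Psi$-equivariantly, into a direct product of copies of $F_\Psi$; (ii) every smooth $F_\Psi$-semilinear representation of $\mathfrak S_\Psi$ of finite length is isomorphic to a (finite) direct sum of copies of $F_\Psi$. -/

import Mathlib

universe u v w

namespace SmSym

open CategoryTheory
open scoped Topology

noncomputable section

/-! ### Smooth semilinear representations of the symmetric group -/

/-- The topology on the group of all permutations of `Ψ` generated by the translates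
`{σ | σ x = y}` of the stabilizers of the elements of `Ψ`. -/
@[reducible]
def permTopology (Ψ : Type u) : TopologicalSpace (Equiv.Perm Ψ) :=
  TopologicalSpace.generateFrom {U | ∃ x y : Ψ, U = {σ : Equiv.Perm Ψ | σ x = y}}

/-- A subgroup containing the pointwise stabilizer of a finite set is open. -/
theorem isOpen_of_fix {Ψ : Type u} (H : Subgroup (Equiv.Perm Ψ)) (T : Finset Ψ)
    (hT : ∀ σ : Equiv.Perm Ψ, (∀ i ∈ T, σ i = i) → σ ∈ H) :
    IsOpen[permTopology Ψ] (H : Set (Equiv.Perm Ψ)) := by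
  let := permTopology Ψ
  rw [isOpen_iff_forall_mem_open]
  intro σ hσ
  refine ⟨⋂ i ∈ T, {τ : Equiv.Perm Ψ | τ i = σ i}, ?_, ?_, ?_⟩
  · intro τ hτ
    have h : σ⁻¹ * τ ∈ H := by
      refine hT _ fun i hi => ?_
      have h1 : τ i = σ i := by simpa using Set.mem_iInter₂.1 hτ i hi
      simp [h1]
    have h2 := H.mul_mem hσ h
    simpa using h2
  · refine isOpen_biInter_finset fun i _ => ?_
    exact TopologicalSpace.isOpen_generateFrom_of_mem ⟨i, σ i, rfl⟩
  · simp

/-- An additive group with an action of a ring `A` and a compatible (semilinear) action of `G` is a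
left module over the skew group ring `A⟨G⟩`, in which `(a[g])(b[h]) = a (g • b) [gh]`;
here `a[g]` acts by `m ↦ a • (g • m)`. -/
@[reducible]
def skewModule (A : Type u) (G : Type v) (M : Type w) [Ring A] [Group G] [MulSemiringAction G A]
    [AddCommGroup M] [Module A M] [DistribMulAction G M]
    (h : ∀ (g : G) (a : A) (m : M), g • a • m = (g • a) • g • m) :
    Module (SkewMonoidAlgebra A G) M :=
  Module.compHom M (SkewMonoidAlgebra.liftNCRingHom (Module.toAddMonoidEnd A M)
    (DistribMulAction.toAddMonoidEnd G M)
    (by intro x y; ext m; exact (h y x m).symm))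

/-- A field `L` with an action of `G` is a semilinear representation of `G` over itself. -/
instance skewModuleSelf (G : Type v) (L : Type w) [Group G] [Field L] [MulSemiringAction G L] :
    Module (SkewMonoidAlgebra L G) L :=
  skewModule L G L fun g a m => by simp [smul_eq_mul, smul_mul']

/-- A field `L` with an action of `G` is a semilinear representation of `G` over any invariant
subfield of `L`. -/
instance skewModuleSubfield (G : Type v) (L : Type w) [Group G] [Field L] [MulSemiringAction G L]
    (K : Subfield L) [IsInvariantSubfield G K] :
    Module (SkewMonoidAlgebra K G) L :=
  skewModule K G L fun g a m => by
    change g • ((a : L) * m) = (g • (a : L)) * (g • m)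
    exact smul_mul' g (a : L) m

theorem skewModuleSelf_single (G : Type v) (L : Type w) [Group G] [Field L]
    [MulSemiringAction G L] (g : G) (a m : L) :
    SkewMonoidAlgebra.single g a • m = a * (g • m) := by
  change (SkewMonoidAlgebra.liftNC _ _ (SkewMonoidAlgebra.single g a) : AddMonoid.End L) m = _
  rw [SkewMonoidAlgebra.liftNC_single]
  rfl

theorem skewModuleSubfield_single (G : Type v) (L : Type w) [Group G] [Field L]
    [MulSemiringAction G L] (K : Subfield L) [IsInvariantSubfield G K] (g : G) (a : K) (m : L) :
    SkewMonoidAlgebra.single g a • m = (a : L) * (g • m) := by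
  change (SkewMonoidAlgebra.liftNC _ _ (SkewMonoidAlgebra.single g a) : AddMonoid.End L) m = _
  rw [SkewMonoidAlgebra.liftNC_single]
  rfl

/-- An `A`-semilinear representation of the symmetric group of `Ψ`, i.e. a left module over the skew
group ring, is smooth if the stabilizers of all its elements are open. -/
def IsSmoothRep (A : Type v) [Ring A] (Ψ : Type u) [MulSemiringAction (Equiv.Perm Ψ) A] :
    ObjectProperty (ModuleCat.{w} (SkewMonoidAlgebra A (Equiv.Perm Ψ))) :=
  fun V => ∀ m : V, IsOpen[permTopology Ψ]
    {σ : Equiv.Perm Ψ | SkewMonoidAlgebra.single σ (1 : A) • m = m}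

/-- The category of smooth `A`-semilinear representations of the symmetric group of `Ψ`: the full
subcategory of the category of left `A⟨𝔖_Ψ⟩`-modules formed by the smooth ones. -/
abbrev Sm (A : Type v) [Ring A] (Ψ : Type u) [MulSemiringAction (Equiv.Perm Ψ) A] :=
  (IsSmoothRep.{u, v, w} A Ψ).FullSubcategory

/-! ### The tensor power `⨂_{k, i ∈ S} F` and its field of fractions `F_S` -/

section TensorPow

variable {F : Type v} [Field F] (k : Subfield F) (S : Type u)

/-- The relations making each `a ↦ X (i, a)` a homomorphism of `k`-algebras. -/
def tensorRel : Set (MvPolynomial (S × F) k) :=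
  {p | ∃ (i : S) (a b : F),
      p = MvPolynomial.X (i, a + b) - (MvPolynomial.X (i, a) + MvPolynomial.X (i, b))} ∪
  {p | ∃ (i : S) (a b : F),
      p = MvPolynomial.X (i, a * b) - MvPolynomial.X (i, a) * MvPolynomial.X (i, b)} ∪
  {p | ∃ (i : S) (c : k), p = MvPolynomial.X (i, (c : F)) - MvPolynomial.C c}

/-- The tensor product over `k` of copies of `F` labeled by a (possibly infinite) set `S`, that is
the coproduct of these copies in the category of commutative `k`-algebras
(see `TensorPow.lift`, `TensorPow.lift_ι` and `TensorPow.algHom_ext` for the universal property):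
its elements are finite linear combinations of tensors with almost all factors equal to `1`. -/
def TensorPow : Type (max u v) :=
  MvPolynomial (S × F) k ⧸ Ideal.span (tensorRel k S)

namespace TensorPow

instance : CommRing (TensorPow k S) :=
  inferInstanceAs (CommRing (MvPolynomial (S × F) k ⧸ Ideal.span (tensorRel k S)))

instance : Algebra k (TensorPow k S) :=
  inferInstanceAs (Algebra k (MvPolynomial (S × F) k ⧸ Ideal.span (tensorRel k S)))

/-- The projection from the polynomial algebra. -/
def proj : MvPolynomial (S × F) k →ₐ[k] TensorPow k S :=
  Ideal.Quotient.mkₐ k (Ideal.span (tensorRel k S))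

theorem proj_surjective : Function.Surjective (proj k S) :=
  Ideal.Quotient.mkₐ_surjective k _

theorem proj_eq {p q : MvPolynomial (S × F) k} (h : p - q ∈ tensorRel k S) :
    proj k S p = proj k S q :=
  Ideal.Quotient.eq.2 (Ideal.subset_span h)

variable {S} in
/-- The embedding `a ↦ a(i)` of the factor labeled by `i`. -/
def ι (i : S) : F →ₐ[k] TensorPow k S :=
  AlgHom.ofLinearMap
    { toFun := fun a => proj k S (MvPolynomial.X (i, a))
      map_add' := fun a b => by
        rw [← map_add]
        exact proj_eq k S (Or.inl (Or.inl ⟨i, a, b, rfl⟩))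
      map_smul' := fun c a => by
        have h1 : proj k S (MvPolynomial.X (i, (c : F) * a)) =
            proj k S (MvPolynomial.X (i, (c : F)) * MvPolynomial.X (i, a)) :=
          proj_eq k S (Or.inl (Or.inr ⟨i, c, a, rfl⟩))
        have h2 : proj k S (MvPolynomial.X (i, (c : F))) = proj k S (MvPolynomial.C c) :=
          proj_eq k S (Or.inr ⟨i, c, rfl⟩)
        rw [Subfield.smul_def, smul_eq_mul, h1, map_mul, h2, ← map_mul, RingHom.id_apply,
          ← map_smul, MvPolynomial.smul_eq_C_mul] }
    (by
      have h2 : proj k S (MvPolynomial.X (i, ((1 : k) : F))) = proj k S (MvPolynomial.C 1) :=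
        proj_eq k S (Or.inr ⟨i, 1, rfl⟩)
      simpa using h2)
    (fun a b => by
      have h1 : proj k S (MvPolynomial.X (i, a * b)) =
          proj k S (MvPolynomial.X (i, a) * MvPolynomial.X (i, b)) :=
        proj_eq k S (Or.inl (Or.inr ⟨i, a, b, rfl⟩))
      simpa using h1)

theorem proj_X (i : S) (a : F) : proj k S (MvPolynomial.X (i, a)) = ι k i a := rfl

variable {S} in
/-- The homomorphism of `k`-algebras given by a family of homomorphisms on the factors. -/
def lift {B : Type w} [CommRing B] [Algebra k B] (f : S → F →ₐ[k] B) : TensorPow k S →ₐ[k] B :=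
  Ideal.Quotient.liftₐ (Ideal.span (tensorRel k S)) (MvPolynomial.aeval fun x => f x.1 x.2)
    (by
      intro p hp
      have hle : Ideal.span (tensorRel k S) ≤
          RingHom.ker (MvPolynomial.aeval (R := k) fun x : S × F => f x.1 x.2) := by
        rw [Ideal.span_le]
        rintro q ((⟨i, a, b, rfl⟩ | ⟨i, a, b, rfl⟩) | ⟨i, c, rfl⟩)
        · simp [RingHom.mem_ker]
        · simp [RingHom.mem_ker]
        · simp only [SetLike.mem_coe, RingHom.mem_ker, map_sub, MvPolynomial.aeval_X,
            MvPolynomial.aeval_C, sub_eq_zero]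
          exact (f i).commutes c
      exact hle hp)

@[simp]
theorem lift_ι {B : Type w} [CommRing B] [Algebra k B] (f : S → F →ₐ[k] B) (i : S) (a : F) :
    lift k f (ι k i a) = f i a := by
  change MvPolynomial.aeval (R := k) (fun x : S × F => f x.1 x.2) (MvPolynomial.X (i, a)) = _
  simp

variable {k S} in
theorem algHom_ext {B : Type w} [CommRing B] [Algebra k B] {f g : TensorPow k S →ₐ[k] B}
    (h : ∀ i a, f (ι k i a) = g (ι k i a)) : f = g := by
  have h1 : f.comp (proj k S) = g.comp (proj k S) :=
    MvPolynomial.algHom_ext fun x => h x.1 x.2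
  ext x
  obtain ⟨p, rfl⟩ := proj_surjective k S x
  exact DFunLike.congr_fun h1 p

/-- The endomorphism permuting the tensor factors: `a(i) ↦ a(σ i)`. -/
def permHom (σ : Equiv.Perm S) : TensorPow k S →ₐ[k] TensorPow k S :=
  lift k fun i => ι k (σ i)

@[simp]
theorem permHom_ι (σ : Equiv.Perm S) (i : S) (a : F) :
    permHom k S σ (ι k i a) = ι k (σ i) a :=
  lift_ι k S _ i a

/-- The symmetric group of `S` acts on the tensor power by permuting the factors. -/
instance : MulSemiringAction (Equiv.Perm S) (TensorPow k S) where
  smul σ x := permHom k S σ x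
  one_smul x := by
    have h : permHom k S 1 = AlgHom.id k _ := algHom_ext fun i a => by simp
    exact DFunLike.congr_fun h x
  mul_smul σ τ x := by
    have h : permHom k S (σ * τ) = (permHom k S σ).comp (permHom k S τ) :=
      algHom_ext fun i a => by simp
    exact DFunLike.congr_fun h x
  smul_zero σ := map_zero (permHom k S σ)
  smul_add σ := map_add (permHom k S σ)
  smul_one σ := map_one (permHom k S σ)
  smul_mul σ := map_mul (permHom k S σ)

theorem smul_def (σ : Equiv.Perm S) (x : TensorPow k S) : σ • x = permHom k S σ x := rfl

theorem exists_fix (x : TensorPow k S) :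
    ∃ T : Finset S, ∀ σ : Equiv.Perm S, (∀ i ∈ T, σ i = i) → σ • x = x := by
  classical
  obtain ⟨p, rfl⟩ := proj_surjective k S x
  induction p using MvPolynomial.induction_on with
  | C c =>
    refine ⟨∅, fun σ _ => ?_⟩
    rw [smul_def, ← MvPolynomial.algebraMap_eq, AlgHom.commutes, AlgHom.commutes]
  | add p q hp hq =>
    obtain ⟨T, hT⟩ := hp
    obtain ⟨T', hT'⟩ := hq
    refine ⟨T ∪ T', fun σ h => ?_⟩
    rw [map_add, smul_add, hT σ fun i hi => h i (Finset.mem_union_left _ hi),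
      hT' σ fun i hi => h i (Finset.mem_union_right _ hi)]
  | mul_X p n hp =>
    obtain ⟨T, hT⟩ := hp
    refine ⟨insert n.1 T, fun σ h => ?_⟩
    rw [map_mul, smul_mul', hT σ fun i hi => h i (Finset.mem_insert_of_mem hi)]
    have h1 : proj k S (MvPolynomial.X n) = ι k n.1 n.2 := rfl
    rw [h1, smul_def, permHom_ι, h n.1 (Finset.mem_insert_self _ _)]

end TensorPow

/-- The field of fractions `F_S` of the tensor power, when the latter is an integral domain. -/
def FracPow : Type (max u v) := FractionRing (TensorPow k S)

namespace FracPow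

variable [IsDomain (TensorPow k S)]

instance : Field (FracPow k S) := inferInstanceAs (Field (FractionRing (TensorPow k S)))

instance : Algebra (TensorPow k S) (FracPow k S) :=
  inferInstanceAs (Algebra (TensorPow k S) (FractionRing (TensorPow k S)))

instance : IsFractionRing (TensorPow k S) (FracPow k S) :=
  inferInstanceAs (IsFractionRing (TensorPow k S) (FractionRing (TensorPow k S)))

/-- The action of the symmetric group of `S` on `F_S` extending the one on the tensor power. -/
instance : MulSemiringAction (Equiv.Perm S) (FracPow k S) :=
  IsFractionRing.mulSemiringAction (Equiv.Perm S) (TensorPow k S) (FracPow k S)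

theorem smul_algebraMap (σ : Equiv.Perm S) (x : TensorPow k S) :
    σ • algebraMap (TensorPow k S) (FracPow k S) x = algebraMap _ _ (σ • x) :=
  IsFractionRing.ringEquivOfRingEquiv_algebraMap _ _

theorem isOpen_stabilizer (x : FracPow k S) :
    IsOpen[permTopology S] {σ : Equiv.Perm S | σ • x = x} := by
  classical
  obtain ⟨a, b, -, rfl⟩ := IsFractionRing.div_surjective (A := TensorPow k S) x
  obtain ⟨T, hT⟩ := TensorPow.exists_fix k S a
  obtain ⟨T', hT'⟩ := TensorPow.exists_fix k S b
  refine isOpen_of_fix (MulAction.stabilizer (Equiv.Perm S) _) (T ∪ T') fun σ h => ?_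
  rw [MulAction.mem_stabilizer_iff, smul_div₀', smul_algebraMap, smul_algebraMap,
    hT σ fun i hi => h i (Finset.mem_union_left _ hi),
    hT' σ fun i hi => h i (Finset.mem_union_right _ hi)]

/-- `F_S` as a smooth `K`-semilinear representation of the symmetric group of `S`, for an invariant
subfield `K`. -/
def obj (K : Subfield (FracPow k S)) [IsInvariantSubfield (Equiv.Perm S) K] :
    Sm.{u, max u v, max u v} K S :=
  ⟨ModuleCat.of (SkewMonoidAlgebra K (Equiv.Perm S)) (FracPow k S), fun x => by
    have h := isOpen_stabilizer k S x
    have h1 : ∀ σ : Equiv.Perm S,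
        SkewMonoidAlgebra.single σ (1 : K) • (x : FracPow k S) = σ • (x : FracPow k S) :=
      fun σ => by simp [skewModuleSubfield_single]
    convert h using 3 with σ
    rw [← h1 σ]⟩

end FracPow

end TensorPow

end

end SmSym

/-! Write L for F_Ψ. Since L is faithfully flat over K, equivariant K-linear maps V → L can be
studied as equivariant L-linear functionals on L ⊗_K V, so one may take K = L. The proof works with
functionals V → L equivariant only under the permutations fixing a finite set J ⊆ Ψ pointwise;
partially defined ones are treated as graphs in V × L.

The engine is descent from J' to a subset J (`IsEquivariantGraph.descend`). Put B = J' \ J. Over the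
subfield carried by the labels outside B, L is generated by elements that the pointwise stabilizer
of B fixes; adjoining these one at a time gives an equivariant linear retraction r of L onto that
subfield (`exists_retraction`). If φ is J'-equivariant, the new value at v is σ⁻¹ r(φ(σ v)), where σ
fixes J and moves a support of v off B. For infinite Ψ such σ exist, and the value does not depend
on σ.

Injectivity is `IsEquivariantGraph.exists_linearMap`. By Dedekind's independence of characters,
vectors are combinations of block vectors, those unchanged when the labels of a finite set T are
permuted. If the span of the orbit of a block vector meets the domain only in 0, extend by zero.
Otherwise some nonzero combination of translates lies in the domain. Enlarging J by the labels of
all blocks but one shrinks the remaining blocks; induction on |T| defines the functional on the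
other translates, the combination then gives it on the last, and descent returns to J.

For the cogenerator property, take J minimal among the sets carrying a functional nonzero on the
subrepresentation generated by v. By descent and minimality, only finitely many of its translates
are nonzero at a given vector, so they can be summed. Dedekind's theorem supplies a scalar twist
that makes the sum nonzero.

Consequently a simple smooth L-semilinear representation is L itself, and injectivity splits every
finite composition series. For perfect k, the tensor power is a domain because F/k is regular. -/

namespace SmSym

/-! ### Regularity of an extension in which a perfect field is algebraically closed -/

open scoped TensorProduct

/-- If `K` is algebraically closed in `F`, minimal polynomials over `K` stay minimal over `F`. -/
theorem minpoly_eq_map_of_algClosedIn {K F Ω : Type*} [Field K] [Field F] [Field Ω] [Algebra K F]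
    [Algebra K Ω] [Algebra F Ω] [IsScalarTower K F Ω]
    (h : ∀ x : F, IsAlgebraic K x → x ∈ (algebraMap K F).range) {x : Ω} (hx : IsIntegral K x) :
    minpoly F x = (minpoly K x).map (algebraMap K F) := by
  have hxF : IsIntegral F x := hx.tower_top
  have hdvd : minpoly F x ∣ (minpoly K x).map (algebraMap K F) :=
    minpoly.dvd_map_of_isScalarTower ..
  -- Coefficients of a monic factor of a polynomial over `K` are integral over `K`, hence lie in `K`
  -- by `h`.
  have hlift := integralClosure.mem_lifts_of_monic_of_dvd_map F (minpoly.monic hx)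
    (minpoly.monic hxF) hdvd
  obtain ⟨q, hq, hqdeg, hqm⟩ := (Polynomial.lifts_and_degree_eq_and_monic
    (f := algebraMap K F) (p := minpoly F x) (by
      rw [Polynomial.lifts_iff_coeff_lifts] at hlift ⊢
      intro n
      obtain ⟨y, hy⟩ := hlift n
      rw [← hy]
      exact h _ (y.2.isAlgebraic))
    (minpoly.monic hxF))
  have hq0 : Polynomial.aeval x q = 0 := by
    rw [← Polynomial.aeval_map_algebraMap F, hq, minpoly.aeval]
  have : minpoly K x = q := by
    refine Polynomial.eq_of_monic_of_associated (minpoly.monic hx) hqm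
      (associated_of_dvd_dvd (minpoly.dvd K x hq0) ?_)
    rw [← Polynomial.map_dvd_map (algebraMap K F) (algebraMap K F).injective hqm, hq]
    exact hdvd
  rw [this, hq]

/-- Perfectness provides a primitive element of `K'`. Its minimal polynomial keeps its degree over
`F`, so its powers stay independent and the two fields are linearly disjoint inside an algebraic
closure of `F`. -/
theorem isDomain_tensor_of_finite {K F K' : Type*} [Field K] [Field F] [Field K'] [Algebra K F]
    [Algebra K K'] [PerfectField K] [FiniteDimensional K K']
    (h : ∀ x : F, IsAlgebraic K x → x ∈ (algebraMap K F).range) :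
    IsDomain (F ⊗[K] K') := by
  let Ω := AlgebraicClosure F
  obtain ⟨a, ha⟩ := Field.exists_primitive_element K K'
  let f : K' →ₐ[K] Ω := IsAlgClosed.lift
  have hf : f.fieldRange = IntermediateField.adjoin K {f a} := by
    rw [← Set.image_singleton, ← IntermediateField.adjoin_map, ha, AlgHom.fieldRange_eq_map]
  have hint : IsIntegral K (f a) := (Algebra.IsIntegral.isIntegral a).map f
  have hmin := minpoly_eq_map_of_algClosedIn h hint
  have hld : f.fieldRange.LinearDisjoint F := by
    rw [hf]
    let pb := IntermediateField.adjoin.powerBasis hint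
    refine IntermediateField.LinearDisjoint.of_basis_left pb.basis ?_
    have hli := linearIndependent_pow (K := F) (f a)
    have hdim : pb.dim = (minpoly F (f a)).natDegree := by
      rw [hmin, Polynomial.natDegree_map]
      exact IntermediateField.adjoin.powerBasis_dim hint
    have := hli.comp (Fin.cast hdim) (Fin.cast_injective hdim)
    convert this using 1
    ext i
    simp [pb]
  have := hld.isDomain
  let e : F ⊗[K] K' ≃ₐ[K] f.fieldRange ⊗[K] F :=
    (Algebra.TensorProduct.comm K F K').trans
      (Algebra.TensorProduct.congr (AlgEquiv.ofInjectiveField f) AlgEquiv.refl)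
  exact e.toMulEquiv.isDomain

theorem map_basis_repr {K F B C ι : Type*} [Field K] [Field F] [CommRing B] [CommRing C]
    [Algebra K F] [Algebra K B] [Algebra K C] (b : Module.Basis ι K F) (φ : B →ₐ[K] C)
    (x : B ⊗[K] F) (i : ι) :
    (Algebra.TensorProduct.basis C b).repr
      (Algebra.TensorProduct.map φ (AlgHom.id K F) x) i =
        φ ((Algebra.TensorProduct.basis B b).repr x i) := by
  induction x using TensorProduct.induction_on with
  | zero => simp
  | tmul x y => simp [Algebra.TensorProduct.basis_repr_tmul]
  | add x y hx hy => simp only [map_add, Finsupp.add_apply, hx, hy]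

/-- Specialization to closed points: pick a nonzero coefficient of each factor. As `B` is a Jacobson
domain, some maximal ideal avoids their product, and its residue field is finite over `K` by the
Nullstellensatz. There both factors remain nonzero, contradicting the finite case. -/
theorem noZeroDivisors_tensor_of_finiteType {K F B : Type*} [Field K] [Field F] [CommRing B]
    [IsDomain B] [Algebra K F] [Algebra K B] [PerfectField K] [Algebra.FiniteType K B]
    (h : ∀ x : F, IsAlgebraic K x → x ∈ (algebraMap K F).range) :
    NoZeroDivisors (B ⊗[K] F) := by
  let b := Module.Free.chooseBasis K F
  refine ⟨fun {x y} hxy => ?_⟩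
  by_contra! hne
  obtain ⟨i, hi⟩ : ∃ i, (Algebra.TensorProduct.basis B b).repr x i ≠ 0 := by
    by_contra! hall
    exact hne.1 ((Algebra.TensorProduct.basis B b).repr.map_eq_zero_iff.1 (Finsupp.ext hall))
  obtain ⟨j, hj⟩ : ∃ i, (Algebra.TensorProduct.basis B b).repr y i ≠ 0 := by
    by_contra! hall
    exact hne.2 ((Algebra.TensorProduct.basis B b).repr.map_eq_zero_iff.1 (Finsupp.ext hall))
  have : IsJacobsonRing B := isJacobsonRing_of_finiteType (A := K)
  have hbot : (⊥ : Ideal B).jacobson = ⊥ := by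
    rw [← Ideal.radical_eq_jacobson, Ideal.IsPrime.radical Ideal.isPrime_bot]
  have hprod := mul_ne_zero hi hj
  rw [Ne, ← Ideal.mem_bot, ← hbot, Ideal.jacobson, Ideal.mem_sInf] at hprod
  push Not at hprod
  obtain ⟨m, ⟨-, hm⟩, hmem⟩ := hprod
  let : Field (B ⧸ m) := Ideal.Quotient.field m
  have : Module.Finite K (B ⧸ m) := finite_of_finite_type_of_isJacobsonRing K (B ⧸ m)
  have : IsDomain (F ⊗[K] (B ⧸ m)) := isDomain_tensor_of_finite h
  have : IsDomain ((B ⧸ m) ⊗[K] F) :=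
    (Algebra.TensorProduct.comm K (B ⧸ m) F).toMulEquiv.isDomain
  let φ := Ideal.Quotient.mkₐ K m
  have hz : Algebra.TensorProduct.map φ (AlgHom.id K F) x *
      Algebra.TensorProduct.map φ (AlgHom.id K F) y = 0 := by
    rw [← map_mul, hxy, map_zero]
  apply hmem
  rcases mul_eq_zero.1 hz with hz | hz
  · refine m.mul_mem_right _ ?_
    rw [← Ideal.Quotient.eq_zero_iff_mem]
    have := map_basis_repr b φ x i
    rw [hz] at this
    exact this.symm.trans (by simp)
  · refine m.mul_mem_left _ ?_
    rw [← Ideal.Quotient.eq_zero_iff_mem]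
    have := map_basis_repr b φ y j
    rw [hz] at this
    exact this.symm.trans (by simp)

/-- A field in which a perfect field is algebraically closed is a regular extension. -/
theorem isDomain_tensor {K F B : Type*} [Field K] [Field F] [CommRing B]
    [IsDomain B] [Algebra K F] [Algebra K B] [PerfectField K]
    (h : ∀ x : F, IsAlgebraic K x → x ∈ (algebraMap K F).range) :
    IsDomain (F ⊗[K] B) := by
  have : NoZeroDivisors (F ⊗[K] B) := by
    refine ⟨fun {x y} hxy => ?_⟩
    obtain ⟨C, hC, hx⟩ := exists_fg_and_mem_baseChange x
    obtain ⟨D, hD, hy⟩ := exists_fg_and_mem_baseChange y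
    have hle : ∀ (P Q : Subalgebra K B), P ≤ Q → ∀ z ∈ P.baseChange F, z ∈ Q.baseChange F := by
      rintro P Q hPQ z ⟨w, rfl⟩
      refine ⟨Algebra.TensorProduct.map (AlgHom.id F F) (Subalgebra.inclusion hPQ) w, ?_⟩
      induction w using TensorProduct.induction_on with
      | zero => simp
      | tmul x y => simp
      | add x y hx hy => simp only [map_add, hx, hy]
    -- Both elements come from one finitely generated subalgebra, whose base change embeds by
    -- flatness.
    obtain ⟨x', rfl⟩ := hle C (C ⊔ D) le_sup_left x hx
    obtain ⟨y', rfl⟩ := hle D (C ⊔ D) le_sup_right y hy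
    have hinj : Function.Injective
        (Algebra.TensorProduct.map (AlgHom.id F F) (C ⊔ D).val) :=
      Module.Flat.lTensor_preserves_injective_linearMap _ Subtype.val_injective
    have : Algebra.FiniteType K ↥(C ⊔ D) :=
      Subalgebra.fg_iff_finiteType _ |>.1 (Subalgebra.FG.sup hC hD)
    have := noZeroDivisors_tensor_of_finiteType (K := K) (F := F) (B := ↥(C ⊔ D)) h
    have : NoZeroDivisors (F ⊗[K] ↥(C ⊔ D)) :=
      (Algebra.TensorProduct.comm K F ↥(C ⊔ D)).injective.noZeroDivisors _
        (map_zero _) (map_mul _)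
    have hz : x' * y' = 0 := hinj (by
      rw [map_zero, map_mul]; exact hxy)
    rcases mul_eq_zero.1 hz with rfl | rfl
    · left; exact map_zero _
    · right; exact map_zero _
  have : Nontrivial (F ⊗[K] B) := inferInstance
  exact NoZeroDivisors.to_isDomain _

end SmSym

/-! ### The tensor power is an integral domain over a perfect field -/

namespace SmSym

open scoped TensorProduct

noncomputable section

namespace TensorPow

variable {F : Type v} [Field F] (k : Subfield F)

/-- The homomorphism of tensor powers induced by a map of index sets. -/
def mapHom {S : Type u} {S' : Type w} (f : S → S') : TensorPow k S →ₐ[k] TensorPow k S' :=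
  lift k fun i => ι k (f i)

theorem mapHom_injective {S : Type u} {S' : Type w} {f : S → S'} {g : S' → S}
    (h : ∀ i, g (f i) = i) : Function.Injective (mapHom k f) := by
  have h1 : (mapHom k g).comp (mapHom k f) = AlgHom.id k _ :=
    algHom_ext fun i a => by simp [mapHom, h]
  exact Function.LeftInverse.injective (g := mapHom k g) fun x => DFunLike.congr_fun h1 x

theorem exists_mem_range_mapHom (S : Type u) (x : TensorPow k S) :
    ∃ T : Finset S, ∀ T' : Finset S, T ⊆ T' →
      x ∈ (mapHom k (Subtype.val : T' → S)).range := by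
  classical
  obtain ⟨p, rfl⟩ := proj_surjective k S x
  induction p using MvPolynomial.induction_on with
  | C c =>
    refine ⟨∅, fun T' _ => ?_⟩
    rw [← MvPolynomial.algebraMap_eq, AlgHom.commutes]
    exact Subalgebra.algebraMap_mem _ c
  | add p q hp hq =>
    obtain ⟨T, hT⟩ := hp
    obtain ⟨T₁, hT₁⟩ := hq
    refine ⟨T ∪ T₁, fun T' h => ?_⟩
    rw [map_add]
    exact add_mem (hT _ (Finset.union_subset_left h)) (hT₁ _ (Finset.union_subset_right h))
  | mul_X p n hp =>
    obtain ⟨T, hT⟩ := hp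
    refine ⟨insert n.1 T, fun T' h => ?_⟩
    rw [map_mul]
    refine mul_mem (hT _ fun i hi => h (Finset.mem_insert_of_mem hi)) ?_
    refine ⟨ι k ⟨n.1, h (Finset.mem_insert_self _ _)⟩ n.2, ?_⟩
    exact lift_ι k _ _ _ _

variable {k}

theorem isDomain_of_finite [PerfectField k] (hkF : ∀ x : F, IsAlgebraic k x → x ∈ k)
    (S : Type u) [Finite S] : IsDomain (TensorPow k S) := by
  induction S using Finite.induction_empty_option with
  | of_equiv e h =>
    rename_i α β
    exact (MulEquiv.ofBijective (mapHom k e.symm : TensorPow k β →ₐ[k] TensorPow k α)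
      ⟨mapHom_injective k e.apply_symm_apply, fun x => ⟨mapHom k e x, by
        have h1 : (mapHom k e.symm).comp (mapHom k e) = AlgHom.id k (TensorPow k α) :=
          algHom_ext fun i a => by simp [mapHom]
        exact DFunLike.congr_fun h1 x⟩⟩).isDomain
  | h_empty =>
    let f : TensorPow k PEmpty →ₐ[k] k := lift k fun i => i.elim
    have hf : Function.Injective f := by
      have h1 : (Algebra.ofId k _).comp f = AlgHom.id k (TensorPow k PEmpty) :=
        algHom_ext fun i => i.elim
      exact Function.LeftInverse.injective (g := Algebra.ofId k _) fun x => DFunLike.congr_fun h1 x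
    exact hf.isDomain f
  | h_option h =>
    rename_i α _
    have h2 : IsDomain (F ⊗[k] TensorPow k α) := isDomain_tensor fun x hx => ⟨⟨x, hkF x hx⟩, rfl⟩
    let f : TensorPow k (Option α) →ₐ[k] F ⊗[k] TensorPow k α := lift k fun i =>
      i.elim Algebra.TensorProduct.includeLeft
        fun i => Algebra.TensorProduct.includeRight.comp (ι k i)
    let g : F ⊗[k] TensorPow k α →ₐ[k] TensorPow k (Option α) :=
      Algebra.TensorProduct.productMap (ι k none) (mapHom k some)
    have hf : Function.Injective f := by
      have h1 : g.comp f = AlgHom.id k _ := algHom_ext fun i a => by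
        cases i <;> simp [f, g, mapHom]
      exact Function.LeftInverse.injective (g := g) fun x => DFunLike.congr_fun h1 x
    exact hf.isDomain f

theorem isDomain_of_perfectField [PerfectField k] (hkF : ∀ x : F, IsAlgebraic k x → x ∈ k)
    (S : Type u) : IsDomain (TensorPow k S) := by
  classical
  rcases isEmpty_or_nonempty S with hS | ⟨⟨i₀⟩⟩
  · exact isDomain_of_finite hkF S
  -- A left inverse of the inclusion of `T` sends all labels outside `T` to `i₀`; this is why `i₀`
  -- is put into every finite set below.
  have hinj : ∀ T : Finset S, i₀ ∈ T →
      Function.Injective (mapHom k (Subtype.val : T → S)) := fun T hT =>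
    mapHom_injective k (g := fun i => if h : i ∈ T then ⟨i, h⟩ else ⟨i₀, hT⟩) fun i => by simp
  have : NoZeroDivisors (TensorPow k S) := by
    refine ⟨fun {x y} hxy => ?_⟩
    obtain ⟨T, hT⟩ := exists_mem_range_mapHom k S x
    obtain ⟨T₁, hT₁⟩ := exists_mem_range_mapHom k S y
    let U := insert i₀ (T ∪ T₁)
    obtain ⟨x', rfl⟩ := hT U (Finset.subset_union_left.trans (Finset.subset_insert _ _))
    obtain ⟨y', rfl⟩ := hT₁ U (Finset.subset_union_right.trans (Finset.subset_insert _ _))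
    have := isDomain_of_finite hkF U
    have hz : x' * y' = 0 := hinj U (Finset.mem_insert_self _ _) (by
      rw [map_zero, map_mul]; exact hxy)
    rcases mul_eq_zero.1 hz with rfl | rfl
    · left; exact map_zero _
    · right; exact map_zero _
  have : Nontrivial (TensorPow k S) := by
    let f : TensorPow k S →ₐ[k] F := lift k fun _ => AlgHom.id k F
    exact f.toRingHom.domain_nontrivial
  exact NoZeroDivisors.to_isDomain _

end TensorPow

end

end SmSym

/-! ### Equivariant retractions onto invariant subfields -/

namespace SmSym

open Polynomial IntermediateField

section Retraction

variable {H L : Type*} [Group H] [Field L] [MulSemiringAction H L]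

/-- The action of a group element on an invariant subfield. -/
def subfieldHom (K : Subfield L) (hK : ∀ h : H, ∀ y ∈ K, h • y ∈ K) (h : H) : K →+* K :=
  ((MulSemiringAction.toRingHom H L h).comp K.subtype).codRestrict K fun y => hK h y y.2

theorem aeval_map_subfieldHom (K : Subfield L) (hK : ∀ h : H, ∀ y ∈ K, h • y ∈ K) {x : L}
    (hx : ∀ h : H, h • x = x) (h : H) (p : K[X]) :
    aeval x (p.map (subfieldHom K hK h)) = h • aeval x p := by
  have h1 := hom_eval₂ p (algebraMap K L) (MulSemiringAction.toRingHom H L h) x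
  rw [aeval_def, aeval_def, eval₂_map]
  refine Eq.trans ?_ h1.symm
  simp only [MulSemiringAction.toRingHom_apply, hx]
  rfl

/-- A fraction of degree 0 is not of the form X·P + N/D with N/D proper: such a fraction has degree
at least 1 if P ≠ 0 and negative degree otherwise. The left side over the right encodes p/q
normalized to degree 0 by a power of X. -/
theorem degree_mul_X_pow_ne {K : Type*} [Field K] {p q P N D : K[X]} (hp : p ≠ 0) (hq : q ≠ 0)
    (hD : D ≠ 0) (hN : N.degree < D.degree) :
    p * D * X ^ q.natDegree ≠ q * X ^ p.natDegree * (X * P * D + N) := by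
  intro h
  have h1 := congrArg degree h
  rw [degree_mul, degree_mul, degree_mul, degree_mul, degree_X_pow, degree_X_pow,
    degree_eq_natDegree hp, degree_eq_natDegree hq, degree_eq_natDegree hD] at h1
  have h2 : (X * P * D + N).degree ≠ D.degree := by
    by_cases hP : P = 0
    · simpa [hP] using hN.ne
    · have h3 : D.degree < (X * P * D).degree := by
        rw [degree_mul, degree_mul, degree_X, degree_eq_natDegree hD, degree_eq_natDegree hP]
        norm_cast
        lia
      rw [degree_add_eq_left_of_degree_lt (hN.trans h3)]
      exact h3.ne'
  apply h2
  by_cases hz : X * P * D + N = 0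
  · rw [hz, degree_zero, WithBot.add_bot] at h1
    norm_cast at h1
  · rw [degree_eq_natDegree hz] at h1
    rw [degree_eq_natDegree hz, degree_eq_natDegree hD]
    norm_cast at h1 ⊢
    lia

/-- An invariant subfield has an equivariant complement in the field obtained from it by adjoining
a fixed element. -/
theorem exists_compl_adjoin (K : Subfield L) (hK : ∀ h : H, ∀ y ∈ K, h • y ∈ K) {x : L}
    (hx : ∀ h : H, h • x = x) :
    ∃ C : Submodule K L, (∀ y ∈ C, y ∈ K⟮x⟯) ∧ (∀ y ∈ K⟮x⟯, ∃ a ∈ K, ∃ c ∈ C, y = a + c) ∧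
      (∀ y ∈ C, y ∈ K → y = 0) ∧ (∀ h : H, ∀ y ∈ C, h • y ∈ C) ∧
      ∀ f ∈ K⟮x⟯, f ≠ 0 → ∃ m : ℤ, f * x ^ m ∉ C := by
  have hmem : ∀ p : K[X], aeval x p ∈ K⟮x⟯ := fun p =>
    algebra_adjoin_le_adjoin K {x} (aeval_mem_adjoin_singleton K x)
  by_cases halg : IsIntegral K x
  · have hrep : ∀ y ∈ K⟮x⟯, ∃ p : K[X], y = aeval x p := fun y hy => by
      rw [← mem_toSubalgebra, adjoin_simple_toSubalgebra_of_isAlgebraic halg.isAlgebraic,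
        Algebra.adjoin_singleton_eq_range_aeval] at hy
      obtain ⟨p, rfl⟩ := hy
      exact ⟨p, rfl⟩
    -- Algebraic case: polynomials in `x` of degree below that of the minimal polynomial, without
    -- constant term.
    let C : Submodule K L :=
      { carrier := {y | ∃ P : K[X], (X * P).degree < (minpoly K x).degree ∧ y = aeval x (X * P)}
        add_mem' := by
          rintro _ _ ⟨P, hP, rfl⟩ ⟨Q, hQ, rfl⟩
          refine ⟨P + Q, ?_, by rw [mul_add, map_add]⟩
          rw [mul_add]
          exact (degree_add_le _ _).trans_lt (max_lt hP hQ)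
        zero_mem' := ⟨0, by simpa [bot_lt_iff_ne_bot] using minpoly.ne_zero halg, by simp⟩
        smul_mem' := by
          rintro c _ ⟨P, hP, rfl⟩
          refine ⟨c • P, ?_, by rw [mul_smul_comm, map_smul]⟩
          rw [mul_smul_comm]
          exact (degree_smul_le _ _).trans_lt hP }
    have h3 : ∀ y ∈ C, y ∈ K → y = 0 := by
      rintro y ⟨P, hP, hy⟩ hyK
      have h0 : aeval x (X * P - Polynomial.C (⟨y, hyK⟩ : K)) = 0 := by
        rw [map_sub, ← hy, aeval_C]
        exact sub_self y
      have h1 : X * P - Polynomial.C (⟨y, hyK⟩ : K) = 0 := by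
        by_contra hne
        refine (minpoly.degree_le_of_ne_zero K x hne h0).not_gt ((degree_sub_le _ _).trans_lt
          (max_lt hP (degree_C_le.trans_lt (minpoly.degree_pos halg))))
      have h2 := congrArg (fun p => coeff p 0) h1
      simp only [coeff_sub, mul_coeff_zero, coeff_X_zero, zero_mul, coeff_C_zero, zero_sub,
        coeff_zero, neg_eq_zero] at h2
      exact congrArg Subtype.val h2
    refine ⟨C, ?_, ?_, h3, ?_, ?_⟩
    · rintro _ ⟨P, -, rfl⟩
      exact hmem _
    · intro y hy
      obtain ⟨p, rfl⟩ := hrep y hy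
      have hmod := modByMonic_eq_sub_mul_div p (minpoly K x)
      have hval : aeval x (p %ₘ minpoly K x) = aeval x p := by
        rw [hmod, map_sub, map_mul, minpoly.aeval, zero_mul, sub_zero]
      have hdecomp := divX_mul_X_add (p %ₘ minpoly K x)
      refine ⟨_, ((p %ₘ minpoly K x).coeff 0).2, aeval x (X * (p %ₘ minpoly K x).divX),
        ⟨_, ?_, rfl⟩, ?_⟩
      · have : X * (p %ₘ minpoly K x).divX =
            p %ₘ minpoly K x - Polynomial.C ((p %ₘ minpoly K x).coeff 0) := by
          rw [eq_sub_iff_add_eq, mul_comm]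
          exact hdecomp
        rw [this]
        exact (degree_sub_le _ _).trans_lt (max_lt (degree_modByMonic_lt _ (minpoly.monic halg))
          (degree_C_le.trans_lt (minpoly.degree_pos halg)))
      · rw [← hval]
        conv_lhs => rw [← hdecomp]
        rw [map_add, aeval_C, add_comm, mul_comm X]
        rfl
    · rintro h _ ⟨P, hP, rfl⟩
      refine ⟨P.map (subfieldHom K hK h), ?_, ?_⟩
      · have : X * P.map (subfieldHom K hK h) = (X * P).map (subfieldHom K hK h) := by simp
        rw [this, degree_map]
        exact hP
      · rw [← aeval_map_subfieldHom K hK hx, Polynomial.map_mul, map_X]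
    · intro f hf hf0
      by_contra! hall
      have hall' : ∀ p : K[X], f * aeval x p ∈ C := fun p => by
        induction p using Polynomial.induction_on' with
        | add p q hp hq =>
          rw [map_add, mul_add]
          exact C.add_mem hp hq
        | monomial n a =>
          rw [← smul_X_eq_monomial, map_smul, mul_smul_comm]
          refine C.smul_mem a ?_
          rw [map_pow, aeval_X, ← zpow_natCast]
          exact hall n
      -- If all f·xⁿ were in `C`, so would be f·K[x], which contains f·f⁻¹ = 1.
      obtain ⟨p, hp⟩ := hrep f⁻¹ (inv_mem hf)
      have h1 := hall' p
      rw [← hp, mul_inv_cancel₀ hf0] at h1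
      exact one_ne_zero (h3 1 h1 K.one_mem)
  · have htr : ∀ p : K[X], aeval x p = 0 → p = 0 := fun p hp => by
      by_contra hne
      exact halg (IsAlgebraic.isIntegral ⟨p, hne, hp⟩)
    have hx0 : x ≠ 0 := fun h => X_ne_zero (htr X (by rw [aeval_X, h]))
    -- Transcendental case: K(x) is K[x] plus proper fractions; `C` drops only the constant term of
    -- the polynomial part.
    let C : Submodule K L :=
      { carrier := {y | ∃ P N D : K[X], D ≠ 0 ∧ N.degree < D.degree ∧
          y * aeval x D = aeval x (X * P * D + N)}
        add_mem' := by
          rintro y z ⟨P, N, D, hD, hN, hy⟩ ⟨P', N', D', hD', hN', hz⟩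
          refine ⟨P + P', N * D' + N' * D, D * D', mul_ne_zero hD hD', ?_, ?_⟩
          · refine (degree_add_le _ _).trans_lt (max_lt ?_ ?_)
            · rw [degree_mul, degree_mul]
              exact WithBot.add_lt_add_right (degree_ne_bot.2 hD') hN
            · rw [degree_mul, degree_mul, add_comm D.degree]
              exact WithBot.add_lt_add_right (degree_ne_bot.2 hD) hN'
          · simp only [map_mul, map_add, aeval_X] at hy hz ⊢
            linear_combination aeval x D' * hy + aeval x D * hz
        zero_mem' := ⟨0, 0, 1, one_ne_zero, by simp, by simp⟩
        smul_mem' := by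
          rintro c y ⟨P, N, D, hD, hN, hy⟩
          refine ⟨c • P, c • N, D, hD, (degree_smul_le _ _).trans_lt hN, ?_⟩
          rw [smul_mul_assoc, hy, ← map_smul]
          congr 1
          simp }
    have key : ∀ p q : K[X], p ≠ 0 → q ≠ 0 →
        aeval x p / aeval x q * x ^ ((q.natDegree : ℤ) - p.natDegree) ∉ C := by
      rintro p q hp hq ⟨P, N, D, hD, hN, h⟩
      refine degree_mul_X_pow_ne (P := P) hp hq hD hN (sub_eq_zero.1 (htr _ ?_))
      have hq0 : aeval x q ≠ 0 := fun h => hq (htr q h)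
      rw [zpow_sub₀ hx0, zpow_natCast, zpow_natCast] at h
      rw [map_sub, map_mul _ (q * _), ← h]
      simp only [map_mul, map_pow, aeval_X]
      field_simp
      ring
    refine ⟨C, ?_, ?_, ?_, ?_, ?_⟩
    · rintro y ⟨P, N, D, hD, hN, hy⟩
      have hD0 : aeval x D ≠ 0 := fun h => hD (htr D h)
      rw [← eq_div_iff hD0] at hy
      rw [hy]
      exact div_mem (hmem _) (hmem _)
    · intro y hy
      obtain ⟨p, q, rfl⟩ := (mem_adjoin_simple_iff K y).1 hy
      by_cases hq : q = 0
      · exact ⟨0, K.zero_mem, 0, C.zero_mem, by simp [hq]⟩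
      have hq0 : aeval x q ≠ 0 := fun h => hq (htr q h)
      refine ⟨_, ((p / q).coeff 0).2, aeval x p / aeval x q - ((p / q).coeff 0 : K),
        ⟨(p / q).divX, p % q, q, hq, EuclideanDomain.mod_lt p hq, ?_⟩, by ring⟩
      have h1 : p = q * (p / q) + p % q := (EuclideanDomain.div_add_mod p q).symm
      have h2 := divX_mul_X_add (p / q)
      have h3 : aeval x p = aeval x q * (aeval x (p / q).divX * x + ((p / q).coeff 0 : K)) +
          aeval x (p % q) := by
        conv_lhs => rw [h1, map_add, map_mul, ← h2, map_add, map_mul, aeval_X, aeval_C]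
        rfl
      simp only [map_mul, map_add, aeval_X]
      field_simp
      rw [h3]
      ring
    · intro y hy hyK
      by_contra hy0
      have h1 := key (Polynomial.C (⟨y, hyK⟩ : K)) 1
        (C_ne_zero.2 fun h => hy0 (congrArg Subtype.val h)) one_ne_zero
      apply h1
      rw [aeval_C, natDegree_C, map_one, natDegree_one, div_one, sub_self, zpow_zero, mul_one]
      exact hy
    · rintro h y ⟨P, N, D, hD, hN, hy⟩
      refine ⟨P.map (subfieldHom K hK h), N.map (subfieldHom K hK h), D.map (subfieldHom K hK h),
        (Polynomial.map_ne_zero hD), by simpa only [degree_map] using hN, ?_⟩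
      have h1 := congrArg (fun z => h • z) hy
      simp only [smul_mul', ← aeval_map_subfieldHom K hK hx, Polynomial.map_add,
        Polynomial.map_mul, map_X] at h1
      exact h1
    · intro f hf hf0
      obtain ⟨p, q, rfl⟩ := (mem_adjoin_simple_iff K f).1 hf
      refine ⟨_, key p q ?_ ?_⟩
      · rintro rfl
        simp at hf0
      · rintro rfl
        simp at hf0

/-- Partial complements of an invariant subfield `E`: `E ⊕ C` is a subfield, `C` is an equivariant
`E`-subspace, and no nonzero element of `E ⊕ C` has all its multiples by invariants in `C`. -/
structure IsPartialCompl (H : Type*) [Group H] [MulSemiringAction H L] (E : Subfield L)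
    (C : AddSubgroup L) : Prop where
  smul_mem : ∀ a ∈ E, ∀ c ∈ C, a * c ∈ C
  stable : ∀ h : H, ∀ c ∈ C, h • c ∈ C
  disjoint : ∀ c ∈ C, c ∈ E → c = 0
  mul_mem : ∀ x ∈ E.toAddSubgroup ⊔ C, ∀ y ∈ E.toAddSubgroup ⊔ C, x * y ∈ E.toAddSubgroup ⊔ C
  inv_mem : ∀ x ∈ E.toAddSubgroup ⊔ C, x⁻¹ ∈ E.toAddSubgroup ⊔ C
  nondeg : ∀ f ∈ E.toAddSubgroup ⊔ C, f ≠ 0 →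
    ∃ y ∈ E.toAddSubgroup ⊔ C, (∀ h : H, h • y = y) ∧ f * y ∉ C

theorem isPartialCompl_bot (E : Subfield L) : IsPartialCompl H E ⊥ where
  smul_mem a _ c hc := by
    rw [AddSubgroup.mem_bot] at hc ⊢
    rw [hc, mul_zero]
  stable h c hc := by
    rw [AddSubgroup.mem_bot] at hc ⊢
    rw [hc, smul_zero]
  disjoint c hc _ := AddSubgroup.mem_bot.1 hc
  mul_mem x hx y hy := by
    rw [sup_bot_eq] at *
    exact E.mul_mem hx hy
  inv_mem x hx := by
    rw [sup_bot_eq] at *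
    exact E.inv_mem hx
  nondeg f hf hf0 :=
    ⟨1, AddSubgroup.mem_sup_left E.one_mem, fun h => smul_one h, by simpa using hf0⟩

/-- Only nondegeneracy needs care. If f·y lies in E ⊕ C and in a larger member D of the chain, its
E-component lies in D ∩ E = 0, so f·y was already in C. -/
theorem isPartialCompl_sSup (E : Subfield L) {c : Set (AddSubgroup L)} (hne : c.Nonempty)
    (hc : IsChain (· ≤ ·) c) (h : ∀ C ∈ c, IsPartialCompl H E C) :
    IsPartialCompl H E (sSup c) := by
  have hmem : ∀ {x}, x ∈ sSup c ↔ ∃ C ∈ c, x ∈ C :=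
    AddSubgroup.mem_sSup_of_directedOn hne hc.directedOn
  have hsup : ∀ {x}, x ∈ E.toAddSubgroup ⊔ sSup c → ∃ C ∈ c, x ∈ E.toAddSubgroup ⊔ C := by
    intro x hx
    obtain ⟨a, ha, d, hd, rfl⟩ := AddSubgroup.mem_sup.1 hx
    obtain ⟨C, hC, hdC⟩ := hmem.1 hd
    exact ⟨C, hC, AddSubgroup.mem_sup.2 ⟨a, ha, d, hdC, rfl⟩⟩
  have hle : ∀ C ∈ c, E.toAddSubgroup ⊔ C ≤ E.toAddSubgroup ⊔ sSup c := fun C hC =>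
    sup_le_sup_left (le_sSup hC) _
  refine ⟨?_, ?_, ?_, ?_, ?_, ?_⟩
  · intro a ha d hd
    obtain ⟨C, hC, hdC⟩ := hmem.1 hd
    exact hmem.2 ⟨C, hC, (h C hC).smul_mem a ha d hdC⟩
  · intro g d hd
    obtain ⟨C, hC, hdC⟩ := hmem.1 hd
    exact hmem.2 ⟨C, hC, (h C hC).stable g d hdC⟩
  · intro d hd
    obtain ⟨C, hC, hdC⟩ := hmem.1 hd
    exact (h C hC).disjoint d hdC
  · intro x hx y hy
    obtain ⟨C, hC, hxC⟩ := hsup hx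
    obtain ⟨D, hD, hyD⟩ := hsup hy
    rcases hc.total hC hD with hCD | hCD
    · exact hle D hD ((h D hD).mul_mem x (sup_le_sup_left hCD _ hxC) y hyD)
    · exact hle C hC ((h C hC).mul_mem x hxC y (sup_le_sup_left hCD _ hyD))
  · intro x hx
    obtain ⟨C, hC, hxC⟩ := hsup hx
    exact hle C hC ((h C hC).inv_mem x hxC)
  · intro f hf hf0
    obtain ⟨C, hC, hfC⟩ := hsup hf
    obtain ⟨y, hy, hyfix, hfy⟩ := (h C hC).nondeg f hfC hf0
    refine ⟨y, hle C hC hy, hyfix, fun hmem' => ?_⟩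
    obtain ⟨D, hD, hyD⟩ := hmem.1 hmem'
    rcases hc.total hC hD with hCD | hCD
    · obtain ⟨a, ha, d, hd, hadd⟩ := AddSubgroup.mem_sup.1 ((h C hC).mul_mem f hfC y hy)
      have h1 : a ∈ D := by
        have := D.sub_mem hyD (hCD hd)
        rwa [← hadd, add_sub_cancel_right] at this
      have h2 := (h D hD).disjoint a h1 ha
      rw [h2, zero_add] at hadd
      exact hfy (hadd ▸ hd)
    · exact hfy (hCD hyD)

/-- Complements compose in towers: with K = E ⊕ C and K(x) = K ⊕ D, take C ⊕ D. For nondegeneracy,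
first use a power of `x` to make the K-component of f nonzero, then an invariant of K to push that
component out of C. -/
theorem IsPartialCompl.exists_adjoin {E : Subfield L} (hE : ∀ h : H, ∀ y ∈ E, h • y ∈ E)
    {C : AddSubgroup L} (hC : IsPartialCompl H E C) {x : L} (hx : ∀ h : H, h • x = x) :
    ∃ C', IsPartialCompl H E C' ∧ C ≤ C' ∧ x ∈ E.toAddSubgroup ⊔ C' := by
  let K : Subfield L :=
    { E.toAddSubgroup ⊔ C with
      mul_mem' := fun {x y} hx hy => hC.mul_mem x hx y hy
      one_mem' := AddSubgroup.mem_sup_left E.one_mem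
      inv_mem' := fun x hx => hC.inv_mem x hx }
  have hKmem : ∀ {y}, y ∈ K ↔ y ∈ E.toAddSubgroup ⊔ C := Iff.rfl
  have hEK : ∀ a ∈ E, a ∈ K := fun a ha => AddSubgroup.mem_sup_left ha
  have hCK : ∀ a ∈ C, a ∈ K := fun a ha => AddSubgroup.mem_sup_right ha
  have hK : ∀ h : H, ∀ y ∈ K, h • y ∈ K := by
    intro h y hy
    obtain ⟨a, ha, c, hc, rfl⟩ := AddSubgroup.mem_sup.1 hy
    rw [smul_add]
    exact K.add_mem (hEK _ (hE h a ha)) (hCK _ (hC.stable h c hc))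
  obtain ⟨D, hDle, hDsup, hDdisj, hDstable, hDnd⟩ := exists_compl_adjoin K hK hx
  have hKadj : ∀ a ∈ K, a ∈ K⟮x⟯ := fun a ha => K⟮x⟯.algebraMap_mem ⟨a, ha⟩
  have hsup : ∀ {y}, y ∈ E.toAddSubgroup ⊔ (C ⊔ D.toAddSubgroup) ↔ y ∈ K⟮x⟯ := by
    intro y
    rw [← sup_assoc]
    constructor
    · intro hy
      obtain ⟨a, ha, d, hd, rfl⟩ := AddSubgroup.mem_sup.1 hy
      exact add_mem (hKadj a ha) (hDle d hd)
    · intro hy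
      obtain ⟨a, ha, d, hd, rfl⟩ := hDsup y hy
      exact AddSubgroup.mem_sup.2 ⟨a, ha, d, hd, rfl⟩
  refine ⟨C ⊔ D.toAddSubgroup, ⟨?_, ?_, ?_, ?_, ?_, ?_⟩, le_sup_left,
    hsup.2 (mem_adjoin_simple_self K x)⟩
  · intro a ha y hy
    obtain ⟨c, hc, d, hd, rfl⟩ := AddSubgroup.mem_sup.1 hy
    rw [mul_add]
    exact add_mem (AddSubgroup.mem_sup_left (hC.smul_mem a ha c hc))
      (AddSubgroup.mem_sup_right (D.smul_mem (⟨a, hEK a ha⟩ : K) hd))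
  · intro h y hy
    obtain ⟨c, hc, d, hd, rfl⟩ := AddSubgroup.mem_sup.1 hy
    rw [smul_add]
    exact add_mem (AddSubgroup.mem_sup_left (hC.stable h c hc))
      (AddSubgroup.mem_sup_right (hDstable h d hd))
  · intro y hy hyE
    obtain ⟨c, hc, d, hd, rfl⟩ := AddSubgroup.mem_sup.1 hy
    have h1 : d = 0 := hDdisj d hd (by
      have := K.sub_mem (hEK _ hyE) (hCK c hc)
      rwa [add_sub_cancel_left] at this)
    rw [h1, add_zero] at hyE ⊢
    exact hC.disjoint c hc hyE
  · intro y hy z hz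
    rw [hsup] at *
    exact MulMemClass.mul_mem hy hz
  · intro y hy
    rw [hsup] at *
    exact InvMemClass.inv_mem hy
  · intro f hf hf0
    rw [hsup] at hf
    obtain ⟨m, hm⟩ := hDnd f hf hf0
    have hxm : x ^ m ∈ K⟮x⟯ := zpow_mem (mem_adjoin_simple_self K x) m
    obtain ⟨a, ha, d, hd, hadd⟩ := hDsup _ (MulMemClass.mul_mem hf hxm)
    have ha0 : a ≠ 0 := by
      rintro rfl
      rw [zero_add] at hadd
      exact hm (hadd ▸ hd)
    obtain ⟨y, hy, hyfix, hay⟩ := hC.nondeg a ha ha0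
    refine ⟨x ^ m * y, hsup.2 (MulMemClass.mul_mem hxm (hKadj y hy)), fun h => ?_,
      fun hmem => hay ?_⟩
    · have h1 : h • x ^ m = (h • x) ^ m := map_zpow₀ (MulSemiringAction.toRingHom H L h) x m
      rw [smul_mul', hyfix, h1, hx]
    · obtain ⟨c, hc, d', hd', hadd'⟩ := AddSubgroup.mem_sup.1 hmem
      rw [← mul_assoc, hadd] at hadd'
      have hyd : d * y ∈ D := by
        rw [mul_comm]
        exact D.smul_mem (⟨y, hy⟩ : K) hd
      have h1 : a * y - c = 0 := hDdisj _ (by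
        have : a * y - c = d' - d * y := by linear_combination -hadd'
        rw [this]
        exact D.sub_mem hd' hyd) (K.sub_mem (K.mul_mem ha hy) (hCK c hc))
      rw [sub_eq_zero.1 h1]
      exact hc

/-- If a field `L` is generated by invariants over an invariant subfield `E`, there is an
equivariant `E`-linear retraction of `L` onto `E`. -/
theorem exists_retraction (E : Subfield L) (hE : ∀ h : H, ∀ y ∈ E, h • y ∈ E) (X : Set L)
    (hX : ∀ h : H, ∀ x ∈ X, h • x = x)
    (hgen : ∀ K : Subfield L, E ≤ K → X ⊆ K → K = ⊤) :
    ∃ r : L →+ L, (∀ x, r x ∈ E) ∧ (∀ a ∈ E, ∀ x, r (a * x) = a * r x) ∧ (∀ a ∈ E, r a = a) ∧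
      (∀ (h : H) (x : L), r (h • x) = h • r x) ∧
      ∀ f : L, f ≠ 0 → ∃ y : L, (∀ h : H, h • y = y) ∧ r (f * y) ≠ 0 := by
  obtain ⟨C, -, hmax⟩ := zorn_le_nonempty₀ {C | IsPartialCompl H E C}
    (fun c hc hchain y hy => ⟨sSup c, isPartialCompl_sSup E ⟨y, hy⟩ hchain hc,
      fun z hz => le_sSup hz⟩) ⊥ (isPartialCompl_bot E)
  have hC : IsPartialCompl H E C := hmax.prop
  have htop : ∀ x, x ∈ E.toAddSubgroup ⊔ C := by
    let K : Subfield L :=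
      { E.toAddSubgroup ⊔ C with
        mul_mem' := fun {x y} hx hy => hC.mul_mem x hx y hy
        one_mem' := AddSubgroup.mem_sup_left E.one_mem
        inv_mem' := fun x hx => hC.inv_mem x hx }
    have hK : K = ⊤ := by
      refine hgen K (fun a (ha : a ∈ E) => (AddSubgroup.mem_sup_left ha : a ∈ E.toAddSubgroup ⊔ C))
        fun x hxX => ?_
      obtain ⟨C', hC', hle, hxC'⟩ := hC.exists_adjoin hE fun h => hX h x hxX
      exact sup_le_sup_left (hmax.le_of_ge hC' hle) _ hxC'
    intro x
    have : x ∈ K := hK ▸ Subfield.mem_top x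
    exact this
  have hdec : ∀ x, ∃ a ∈ E, x - a ∈ C := fun x => by
    obtain ⟨a, ha, c, hc, rfl⟩ := AddSubgroup.mem_sup.1 (htop x)
    exact ⟨a, ha, by rwa [add_sub_cancel_left]⟩
  choose r hrE hrC using hdec
  have huniq : ∀ x a, a ∈ E → x - a ∈ C → r x = a := fun x a ha hx => by
    have h1 := C.sub_mem hx (hrC x)
    rw [sub_sub_sub_cancel_left] at h1
    exact sub_eq_zero.1 (hC.disjoint _ h1 (E.sub_mem (hrE x) ha))
  refine ⟨AddMonoidHom.mk' r fun x y => huniq _ _ (E.add_mem (hrE x) (hrE y)) ?_, hrE, ?_, ?_,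
    ?_, ?_⟩
  · have := C.add_mem (hrC x) (hrC y)
    rwa [sub_add_sub_comm] at this
  · intro a ha x
    refine huniq _ _ (E.mul_mem ha (hrE x)) ?_
    rw [← mul_sub]
    exact hC.smul_mem a ha _ (hrC x)
  · intro a ha
    exact huniq _ _ ha (by simp)
  · intro h x
    refine huniq _ _ (hE h _ (hrE x)) ?_
    rw [← smul_sub]
    exact hC.stable h _ (hrC x)
  · intro f hf
    obtain ⟨y, -, hy, hfy⟩ := hC.nondeg f (htop f) hf
    refine ⟨y, hy, fun h0 => hfy ?_⟩
    have := hrC (f * y)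
    change r (f * y) = 0 at h0
    rwa [h0, sub_zero] at this

end Retraction

end SmSym

/-! ### Finite supports and extension of partial injections to permutations -/

namespace SmSym

section Supports

variable {Ψ : Type*}

/-- The finite set `T` supports `b`: permutations fixing `T` pointwise fix `b`. -/
def Supp {β : Type*} [SMul (Equiv.Perm Ψ) β] (T : Finset Ψ) (b : β) : Prop :=
  ∀ g : Equiv.Perm Ψ, (∀ i ∈ T, g i = i) → g • b = b

theorem Supp.mono {β : Type*} [SMul (Equiv.Perm Ψ) β] {T T' : Finset Ψ} (h : T ⊆ T') {b : β}
    (hb : Supp T b) : Supp T' b := fun g hg => hb g fun i hi => hg i (h hi)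

theorem Supp.smul_eq_smul {β : Type*} [MulAction (Equiv.Perm Ψ) β] {T : Finset Ψ} {b : β}
    (hb : Supp T b) {g h : Equiv.Perm Ψ} (hgh : ∀ i ∈ T, g i = h i) : g • b = h • b := by
  rw [← inv_smul_eq_iff, ← mul_smul]
  exact hb _ fun i hi => by simp [hgh i hi]

theorem Supp.smul [DecidableEq Ψ] {β : Type*} [MulAction (Equiv.Perm Ψ) β] {T : Finset Ψ} {b : β}
    (hb : Supp T b) (g : Equiv.Perm Ψ) : Supp (T.image g) (g • b) := by
  intro h hh
  rw [← mul_smul]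
  exact hb.smul_eq_smul fun i hi => hh _ (Finset.mem_image_of_mem g hi)

theorem exists_perm_extending (S : Finset Ψ) {f : Ψ → Ψ} (hf : Set.InjOn f S) :
    ∃ g : Equiv.Perm Ψ, ∀ i ∈ S, g i = f i := by
  have h := (Equiv.Perm.isMultiplyPretransitive Ψ S.card).exists_smul_eq
  let e := S.equivFin.symm
  obtain ⟨g, hg⟩ := h (e.toEmbedding.trans (Function.Embedding.subtype _))
    ⟨fun i => f (e i), fun i j hij => e.injective (Subtype.ext (hf (e i).2 (e j).2 hij))⟩
  refine ⟨g, fun i hi => ?_⟩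
  have h1 : g (e (S.equivFin ⟨i, hi⟩)) = f (e (S.equivFin ⟨i, hi⟩)) :=
    DFunLike.congr_fun hg (S.equivFin ⟨i, hi⟩)
  have h2 : e (S.equivFin ⟨i, hi⟩) = ⟨i, hi⟩ := S.equivFin.symm_apply_apply _
  rwa [h2] at h1

/-- The labels of `T` outside `J` are sent to fresh ones outside `J ∪ B`; this room is what infinite
`Ψ` provides. -/
theorem exists_perm_move [Infinite Ψ] (J B T : Finset Ψ) (hJB : Disjoint J B) :
    ∃ g : Equiv.Perm Ψ, (∀ i ∈ J, g i = i) ∧ ∀ i ∈ T, g i ∉ B := by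
  classical
  have hinf : Infinite ((J ∪ B : Finset Ψ) : Set Ψ)ᶜ.Elem :=
    (J ∪ B).finite_toSet.infinite_compl.to_subtype
  let e := Infinite.natEmbedding ((J ∪ B : Finset Ψ) : Set Ψ)ᶜ.Elem
  let c : Ψ → Ψ := fun i => if h : i ∈ T then (e (T.equivFin ⟨i, h⟩)).1 else i
  have hc : ∀ i ∈ T, c i ∉ J ∪ B := fun i hi => by
    simp only [c, hi, dif_pos]
    exact (e _).2
  obtain ⟨g, hg⟩ := exists_perm_extending (J ∪ T) (f := fun i => if i ∈ J then i else c i) (by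
    intro i hi j hj hij
    simp only [Finset.coe_union, Set.mem_union, Finset.mem_coe] at hi hj
    by_cases hiJ : i ∈ J <;> by_cases hjJ : j ∈ J <;> simp only [hiJ, hjJ, if_true, if_false] at hij
    · exact hij
    · exact (hc j (hj.resolve_left hjJ) (Finset.mem_union_left _ (hij ▸ hiJ))).elim
    · exact (hc i (hi.resolve_left hiJ) (Finset.mem_union_left _ (hij ▸ hjJ))).elim
    · have h1 := hi.resolve_left hiJ
      have h2 := hj.resolve_left hjJ
      simp only [c, h1, h2, dif_pos] at hij
      have h3 := e.injective (Subtype.ext hij)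
      simpa [Fin.val_inj] using h3)
  refine ⟨g, fun i hi => ?_, fun i hi => ?_⟩
  · rw [hg i (Finset.mem_union_left _ hi), if_pos hi]
  · rw [hg i (Finset.mem_union_right _ hi)]
    split_ifs with h
    · exact Finset.disjoint_left.1 hJB h
    · exact fun h1 => hc i hi (Finset.mem_union_right _ h1)

end Supports

/-! ### Fields generated by permuted labeled elements -/

section Generated

variable {Ψ A L : Type*} [Field L] [MulSemiringAction (Equiv.Perm Ψ) L]

/-- The subfield generated by the invariants and the elements with labels in `S`. -/
def subfieldOn (ξ : Ψ → A → L) (S : Set Ψ) : Subfield L :=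
  Subfield.closure ({x | ∃ i ∈ S, ∃ a, x = ξ i a} ∪ {x | ∀ g : Equiv.Perm Ψ, g • x = x})

variable {ξ : Ψ → A → L}

theorem mem_subfieldOn {S : Set Ψ} {i : Ψ} (hi : i ∈ S) (a : A) : ξ i a ∈ subfieldOn ξ S :=
  Subfield.subset_closure (Or.inl ⟨i, hi, a, rfl⟩)

theorem subfieldOn_mono {S S' : Set Ψ} (h : S ⊆ S') : subfieldOn ξ S ≤ subfieldOn ξ S' :=
  Subfield.closure_mono (Set.union_subset_union_left _ fun _ ⟨i, hi, a, hx⟩ => ⟨i, h hi, a, hx⟩)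

theorem exists_finset_of_mem_subfieldOn {S : Set Ψ} {x : L} (hx : x ∈ subfieldOn ξ S) :
    ∃ T : Finset Ψ, (T : Set Ψ) ⊆ S ∧ x ∈ subfieldOn ξ (T : Set Ψ) := by
  classical
  induction hx using Subfield.closure_induction with
  | mem x hx =>
    obtain ⟨i, hi, a, rfl⟩ | hx := hx
    swap
    · exact ⟨∅, by simp, Subfield.subset_closure (Or.inr hx)⟩
    exact ⟨{i}, by simpa using hi, mem_subfieldOn (by simp) a⟩
  | one => exact ⟨∅, by simp, one_mem _⟩
  | add x y _ _ hx hy =>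
    obtain ⟨T, hT, hx⟩ := hx
    obtain ⟨T', hT', hy⟩ := hy
    exact ⟨T ∪ T', by simp [hT, hT'],
      add_mem (subfieldOn_mono (by simp) hx) (subfieldOn_mono (by simp) hy)⟩
  | neg x _ hx =>
    obtain ⟨T, hT, hx⟩ := hx
    exact ⟨T, hT, neg_mem hx⟩
  | inv x _ hx =>
    obtain ⟨T, hT, hx⟩ := hx
    exact ⟨T, hT, inv_mem hx⟩
  | mul x y _ _ hx hy =>
    obtain ⟨T, hT, hx⟩ := hx
    obtain ⟨T', hT', hy⟩ := hy
    exact ⟨T ∪ T', by simp [hT, hT'],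
      mul_mem (subfieldOn_mono (by simp) hx) (subfieldOn_mono (by simp) hy)⟩

/-- The field `L` is generated by elements `ξ i a` permuted by the symmetric group of `Ψ`, which
acts on them faithfully. -/
structure IsSymGenerated (ξ : Ψ → A → L) : Prop where
  smul : ∀ (g : Equiv.Perm Ψ) i a, g • ξ i a = ξ (g i) a
  closure_eq_top : subfieldOn ξ Set.univ = ⊤
  separated : ∃ a, Function.Injective fun i => ξ i a

namespace IsSymGenerated

theorem smul_mem (hξ : IsSymGenerated ξ) {S S' : Set Ψ} {g : Equiv.Perm Ψ}
    (hg : ∀ i ∈ S, g i ∈ S') {x : L}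
    (hx : x ∈ subfieldOn ξ S) : g • x ∈ subfieldOn ξ S' := by
  have h : subfieldOn ξ S ≤ (subfieldOn ξ S').comap (MulSemiringAction.toRingHom _ L g) := by
    refine Subfield.closure_le.2 ?_
    rintro x (⟨i, hi, a, rfl⟩ | hx)
    swap
    · exact Subfield.subset_closure (Or.inr fun h => by
        rw [MulSemiringAction.toRingHom_apply, hx g, hx h])
    change g • ξ i a ∈ subfieldOn ξ S'
    rw [hξ.smul]
    exact mem_subfieldOn (hg i hi) a
  exact h hx

theorem smul_eq_smul (hξ : IsSymGenerated ξ) {S : Set Ψ} {g h : Equiv.Perm Ψ}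
    (hgh : ∀ i ∈ S, g i = h i) {x : L}
    (hx : x ∈ subfieldOn ξ S) : g • x = h • x := by
  have hle : subfieldOn ξ S ≤ RingHom.eqLocusField (MulSemiringAction.toRingHom _ L g)
      (MulSemiringAction.toRingHom _ L h) := by
    refine Subfield.closure_le.2 ?_
    rintro x (⟨i, hi, a, rfl⟩ | hx)
    swap
    · exact (hx g).trans (hx h).symm
    change g • ξ i a = h • ξ i a
    rw [hξ.smul, hξ.smul, hgh i hi]
  exact hle hx

theorem supp (hξ : IsSymGenerated ξ) {T : Finset Ψ} {x : L} (hx : x ∈ subfieldOn ξ (T : Set Ψ)) :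
    Supp T x := by
  intro g hg
  have := hξ.smul_eq_smul (g := g) (h := 1) (fun i hi => by simpa using hg i hi) hx
  rwa [one_smul] at this

theorem exists_finset_mem (hξ : IsSymGenerated ξ) (x : L) :
    ∃ T : Finset Ψ, x ∈ subfieldOn ξ (T : Set Ψ) := by
  have hx : x ∈ subfieldOn ξ Set.univ := hξ.closure_eq_top ▸ Subfield.mem_top x
  obtain ⟨T, -, h⟩ := exists_finset_of_mem_subfieldOn hx
  exact ⟨T, h⟩

end IsSymGenerated

/-- A retraction onto the subfield generated by the elements with labels outside `B`. -/
structure IsRetraction (ξ : Ψ → A → L) (B : Finset Ψ) (r : L →+ L) : Prop where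
  mem : ∀ x, r x ∈ subfieldOn ξ (B : Set Ψ)ᶜ
  map_mul : ∀ a ∈ subfieldOn ξ (B : Set Ψ)ᶜ, ∀ x, r (a * x) = a * r x
  map_self : ∀ a ∈ subfieldOn ξ (B : Set Ψ)ᶜ, r a = a
  map_smul : ∀ g : Equiv.Perm Ψ, (∀ i ∈ B, g i = i) → ∀ x, r (g • x) = g • r x

/-- The group is the pointwise stabilizer of `B`: it preserves the subfield carried by the other
labels and fixes the elements with labels in `B`, which generate `L` over that subfield. The factor
y later keeps a given nonzero value from being killed by r. -/
theorem IsSymGenerated.exists_retraction (hξ : IsSymGenerated ξ) (B : Finset Ψ) :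
    ∃ r : L →+ L, IsRetraction ξ B r ∧ ∀ f : L, f ≠ 0 → ∃ y : L, Supp B y ∧ r (f * y) ≠ 0 := by
  obtain ⟨r, h1, h2, h3, h4, h5⟩ := SmSym.exists_retraction
    (H := fixingSubgroup (Equiv.Perm Ψ) (B : Set Ψ)) (subfieldOn ξ (B : Set Ψ)ᶜ)
    (fun h y hy => hξ.smul_mem (S := (B : Set Ψ)ᶜ) (S' := (B : Set Ψ)ᶜ) (g := (h : Equiv.Perm Ψ))
      (fun i (hi : i ∉ B) (hi' : (h : Equiv.Perm Ψ) i ∈ B) => hi (by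
      have h6 := (mem_fixingSubgroup_iff _).1 h.2 _ hi'
      have h7 : (h : Equiv.Perm Ψ) i = i := (h : Equiv.Perm Ψ).injective h6
      rwa [← h7])) hy)
    {x | ∃ i ∈ B, ∃ a, x = ξ i a}
    (by
      rintro h _ ⟨i, hi, a, rfl⟩
      have h6 := (mem_fixingSubgroup_iff _).1 h.2 i hi
      exact (hξ.smul _ i a).trans (congrArg (fun j => ξ j a) h6))
    (by
      intro K hK hX
      rw [eq_top_iff, ← hξ.closure_eq_top]
      refine Subfield.closure_le.2 ?_
      rintro x (⟨i, -, a, rfl⟩ | hx)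
      swap
      · exact hK (Subfield.subset_closure (Or.inr hx))
      by_cases hi : i ∈ B
      · exact hX ⟨i, hi, a, rfl⟩
      · exact hK (mem_subfieldOn hi a))
  refine ⟨r, ⟨h1, h2, h3, fun g hg x => ?_⟩, fun f hf => ?_⟩
  · exact h4 ⟨g, (mem_fixingSubgroup_iff _).2 hg⟩ x
  · obtain ⟨y, hy, hfy⟩ := h5 f hf
    exact ⟨y, fun g hg => hy ⟨g, (mem_fixingSubgroup_iff _).2 hg⟩, hfy⟩

end Generated

end SmSym

/-! ### Partial equivariant functionals and descent to fewer fixed labels -/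

namespace SmSym

section EquivariantGraph

variable {Ψ A L V : Type*} [Field L] [MulSemiringAction (Equiv.Perm Ψ) L] {ξ : Ψ → A → L}
  [AddCommGroup V] [Module L V] [DistribMulAction (Equiv.Perm Ψ) V]

variable (L V) in
/-- `V` is a smooth semilinear representation. -/
structure IsSmoothSemilinear : Prop where
  smul_smul : ∀ (g : Equiv.Perm Ψ) (a : L) (v : V), g • a • v = (g • a) • g • v
  exists_supp : ∀ v : V, ∃ T : Finset Ψ, Supp T v

/-- `Γ` is the graph of a partially defined functional `V → L` equivariant under the permutations
fixing `J` pointwise. -/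
structure IsEquivariantGraph (J : Finset Ψ) (Γ : Submodule L (V × L)) : Prop where
  single : ∀ y, (0, y) ∈ Γ → y = 0
  stable : ∀ g : Equiv.Perm Ψ, (∀ i ∈ J, g i = i) → ∀ p ∈ Γ, g • p ∈ Γ

theorem IsEquivariantGraph.mono {J J' : Finset Ψ} (h : J ⊆ J') {Γ : Submodule L (V × L)}
    (hΓ : IsEquivariantGraph J Γ) : IsEquivariantGraph J' Γ :=
  ⟨hΓ.single, fun g hg => hΓ.stable g fun i hi => hg i (h hi)⟩

/-- The prescription "identity on `J'`, σ i ↦ σ' i on `T`" is consistent and injective: σ and σ'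
agree on `J`, and outside `J` neither sends a label of `T` into `J'`. -/
theorem exists_perm_eq_comp {J J' T : Finset Ψ} (hJ : J ⊆ J') {σ σ' : Equiv.Perm Ψ}
    (hσ : ∀ i ∈ J, σ i = i) (hσ' : ∀ i ∈ J, σ' i = i) (hT : ∀ i ∈ T, σ i ∈ J' → i ∈ J)
    (hT' : ∀ i ∈ T, σ' i ∈ J' → i ∈ J) :
    ∃ g : Equiv.Perm Ψ, (∀ i ∈ J', g i = i) ∧ ∀ i ∈ T, g (σ i) = σ' i := by
  classical
  obtain ⟨g, hg⟩ := exists_perm_extending (J' ∪ T.image σ)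
    (f := fun i => if i ∈ J' then i else σ' (σ⁻¹ i)) (by
      have key : ∀ i ∈ J', ∀ j ∈ T, σ j ∉ J' → i ≠ σ' (σ⁻¹ (σ j)) := by
        intro i hi j hj hjJ h
        rw [show σ⁻¹ (σ j) = j from σ.symm_apply_apply j] at h
        have h1 := hT' j hj (h ▸ hi)
        exact hjJ (by rw [hσ j h1]; exact hJ h1)
      intro i hi j hj hij
      simp only [Finset.coe_union, Set.mem_union, Finset.mem_coe, Finset.mem_image] at hi hj
      by_cases hiJ : i ∈ J' <;> by_cases hjJ : j ∈ J' <;>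
        simp only [hiJ, hjJ, if_true, if_false] at hij
      · exact hij
      · obtain ⟨t, ht, rfl⟩ := hj.resolve_left hjJ
        exact (key i hiJ t ht hjJ hij).elim
      · obtain ⟨t, ht, rfl⟩ := hi.resolve_left hiJ
        exact (key j hjJ t ht hiJ hij.symm).elim
      · exact σ⁻¹.injective (σ'.injective hij))
  refine ⟨g, fun i hi => ?_, fun i hi => ?_⟩
  · rw [hg i (Finset.mem_union_left _ hi), if_pos hi]
  · rw [hg _ (Finset.mem_union_right _ (Finset.mem_image_of_mem σ hi))]
    split_ifs with h
    · have h1 := hT i hi h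
      rw [hσ i h1, hσ' i h1]
    · exact congrArg σ' (σ.symm_apply_apply i)

/-- With φ the functional of `Γ₁`, the new one is v ↦ σ⁻¹ r(φ(σ v)), for σ fixing `J` and moving
supports off `J' \ J`. On vectors already supported off `J' \ J` one may take σ = 1, which gives r ∘
φ. -/
theorem IsEquivariantGraph.descend [Infinite Ψ] [DecidableEq Ψ] (hξ : IsSymGenerated ξ)
    (hV : IsSmoothSemilinear (Ψ := Ψ) L V) {J J' : Finset Ψ} (hJ : J ⊆ J')
    {Γ Γ₁ : Submodule L (V × L)} (hΓ : IsEquivariantGraph J Γ) (hΓ₁ : IsEquivariantGraph J' Γ₁)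
    (hle : Γ ≤ Γ₁) {r : L →+ L} (hr : IsRetraction ξ (J' \ J) r) :
    ∃ Γ' : Submodule L (V × L), IsEquivariantGraph J Γ' ∧ Γ ≤ Γ' ∧
      ∀ p ∈ Γ₁, ∀ T : Finset Ψ, Supp T p.1 → Disjoint T (J' \ J) → (p.1, r p.2) ∈ Γ' := by
  let P : Equiv.Perm Ψ → V × L → Prop := fun σ p => ∃ z, (σ • p.1, z) ∈ Γ₁ ∧ σ • p.2 = r z
  have hdisj : Disjoint J (J' \ J) := Finset.disjoint_sdiff
  -- Independence of σ: two admissible choices differ on `T` by a permutation fixing `J'`, under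
  -- which `Γ₁` is stable and r is equivariant.
  have htransfer : ∀ {σ σ' : Equiv.Perm Ψ} {T : Finset Ψ} {p : V × L}, (∀ i ∈ J, σ i = i) →
      (∀ i ∈ J, σ' i = i) → (∀ i ∈ T, σ i ∉ J' \ J) → (∀ i ∈ T, σ' i ∉ J' \ J) → Supp T p →
      P σ p → P σ' p := by
    rintro σ σ' T p hσ hσ' hT hT' hp ⟨z, hz, hzp⟩
    have haux : ∀ {τ : Equiv.Perm Ψ}, (∀ i ∈ J, τ i = i) → (∀ i ∈ T, τ i ∉ J' \ J) →
        ∀ i ∈ T, τ i ∈ J' → i ∈ J := by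
      intro τ hτ hτT i hi hiJ
      have h1 : τ i ∈ J := by
        by_contra h
        exact hτT i hi (Finset.mem_sdiff.2 ⟨hiJ, h⟩)
      rwa [← τ.injective (hτ _ h1)]
    obtain ⟨g, hgJ, hgT⟩ := exists_perm_eq_comp hJ hσ hσ' (haux hσ hT) (haux hσ' hT')
    have hgp : g • σ • p = σ' • p := by
      rw [← mul_smul]
      exact hp.smul_eq_smul hgT
    refine ⟨g • z, ?_, ?_⟩
    · have h1 := hΓ₁.stable g hgJ _ hz
      rw [Prod.smul_mk, show g • σ • p.1 = σ' • p.1 from congrArg Prod.fst hgp] at h1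
      exact h1
    · rw [hr.map_smul g fun i hi => hgJ i (Finset.mem_sdiff.1 hi).1, ← hzp]
      exact (congrArg Prod.snd hgp).symm
  let Γ' : Submodule L (V × L) :=
    { carrier := {p | ∃ σ : Equiv.Perm Ψ, (∀ i ∈ J, σ i = i) ∧ ∃ T : Finset Ψ,
        (∀ i ∈ T, σ i ∉ J' \ J) ∧ Supp T p ∧ P σ p}
      add_mem' := by
        rintro p q ⟨σ, hσ, T, hT, hp, hPp⟩ ⟨τ, hτ, U, hU, hq, hPq⟩
        obtain ⟨ρ, hρ, hρT⟩ := exists_perm_move J (J' \ J) (T ∪ U) hdisj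
        obtain ⟨z, hz, hzp⟩ := htransfer hσ hρ hT
          (fun i hi => hρT i (Finset.mem_union_left _ hi)) hp hPp
        obtain ⟨z', hz', hzq⟩ := htransfer hτ hρ hU
          (fun i hi => hρT i (Finset.mem_union_right _ hi)) hq hPq
        refine ⟨ρ, hρ, T ∪ U, hρT, fun g hg => ?_, z + z', ?_, ?_⟩
        · rw [smul_add, hp.mono Finset.subset_union_left g hg,
            hq.mono Finset.subset_union_right g hg]
        · have := Γ₁.add_mem hz hz'
          rw [Prod.mk_add_mk, ← smul_add] at this
          exact this
        · rw [Prod.snd_add, smul_add, hzp, hzq, map_add]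
      zero_mem' := ⟨1, fun i _ => rfl, ∅, by simp, fun g _ => smul_zero g, 0, by
        rw [Prod.fst_zero, smul_zero]
        exact Γ₁.zero_mem, by rw [Prod.snd_zero, smul_zero, map_zero]⟩
      smul_mem' := by
        rintro c p ⟨σ, hσ, T, hT, hp, hPp⟩
        obtain ⟨U, hU⟩ := hξ.exists_finset_mem c
        -- Moving the labels of the scalar as well puts ρ • c in the subfield over which r is
        -- linear.
        obtain ⟨ρ, hρ, hρT⟩ := exists_perm_move J (J' \ J) (T ∪ U) hdisj
        obtain ⟨z, hz, hzp⟩ := htransfer hσ hρ hT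
          (fun i hi => hρT i (Finset.mem_union_left _ hi)) hp hPp
        refine ⟨ρ, hρ, T ∪ U, hρT, fun g hg => ?_, (ρ • c) * z, ?_, ?_⟩
        · have h1 := (hξ.supp hU).mono Finset.subset_union_right g hg
          have h2 := hp.mono Finset.subset_union_left g hg
          refine Prod.ext ?_ ?_
          · change g • c • p.1 = c • p.1
            rw [hV.smul_smul, h1]
            exact congrArg (fun q : V × L => c • q.1) h2
          · change g • (c * p.2) = c * p.2
            rw [smul_mul', h1]
            exact congrArg (fun q : V × L => c * q.2) h2
        · have := Γ₁.smul_mem (ρ • c) hz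
          rw [Prod.smul_mk, ← hV.smul_smul] at this
          exact this
        · have hc : ρ • c ∈ subfieldOn ξ ((J' \ J : Finset Ψ) : Set Ψ)ᶜ :=
            hξ.smul_mem (fun i hi => hρT i (Finset.mem_union_right _ hi)) hU
          rw [hr.map_mul _ hc, ← hzp]
          exact smul_mul' ρ c p.2 }
  refine ⟨Γ', ⟨?_, ?_⟩, ?_, ?_⟩
  · rintro y ⟨σ, -, -, -, -, z, hz, hy⟩
    rw [smul_zero] at hz
    rw [hΓ₁.single z hz, map_zero] at hy
    exact (smul_eq_zero_iff_eq σ).1 hy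
  · rintro g hg p ⟨σ, hσ, T, hT, hp, z, hz, hzp⟩
    have hg' : ∀ i ∈ J, g⁻¹ i = i := fun i hi => by
      rw [Equiv.Perm.inv_eq_iff_eq, hg i hi]
    refine ⟨σ * g⁻¹, fun i hi => ?_, T.image g, ?_, hp.smul g, z, ?_, ?_⟩
    · rw [Equiv.Perm.mul_apply, hg' i hi, hσ i hi]
    · intro i hi
      obtain ⟨j, hj, rfl⟩ := Finset.mem_image.1 hi
      rw [Equiv.Perm.mul_apply, show g⁻¹ (g j) = j from g.symm_apply_apply j]
      exact hT j hj
    · rw [Prod.smul_fst, smul_smul, inv_mul_cancel_right]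
      exact hz
    · rw [Prod.smul_snd, smul_smul, inv_mul_cancel_right]
      exact hzp
  · intro p hp
    obtain ⟨T, hT⟩ := hV.exists_supp p.1
    obtain ⟨U, hU⟩ := hξ.exists_finset_mem p.2
    obtain ⟨ρ, hρ, hρT⟩ := exists_perm_move J (J' \ J) (T ∪ U) hdisj
    refine ⟨ρ, hρ, T ∪ U, hρT, fun g hg => Prod.ext (hT.mono Finset.subset_union_left g hg)
      ((hξ.supp hU).mono Finset.subset_union_right g hg), ρ • p.2,
      hle (hΓ.stable ρ hρ p hp), ?_⟩
    -- `Γ` is already stable under ρ, and r fixes the moved value because its labels avoid `J' \ J`.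
    exact (hr.map_self _
      (hξ.smul_mem (fun i hi => hρT i (Finset.mem_union_right _ hi)) hU)).symm
  · intro p hp T hT hTB
    obtain ⟨U, hUB, hU⟩ := exists_finset_of_mem_subfieldOn (hr.mem p.2)
    refine ⟨1, fun i _ => rfl, T ∪ U, ?_, fun g hg => Prod.ext
      (hT.mono Finset.subset_union_left g hg)
      ((hξ.supp hU).mono Finset.subset_union_right g hg), p.2, ?_, one_smul _ _⟩
    · intro i hi
      rcases Finset.mem_union.1 hi with hi | hi
      · exact Finset.disjoint_left.1 hTB hi
      · exact hUB hi
    · rw [one_smul]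
      exact hp

end EquivariantGraph

end SmSym

/-! ### Extending a partial functional to one more vector -/

namespace SmSym

section Extension

variable {Ψ A L V : Type*} [Field L] [MulSemiringAction (Equiv.Perm Ψ) L] {ξ : Ψ → A → L}
  [AddCommGroup V] [Module L V] [DistribMulAction (Equiv.Perm Ψ) V]

/-- Extension by zero to a stable subspace meeting the domain trivially. -/
theorem IsEquivariantGraph.sup_prod_bot {J : Finset Ψ} {Γ : Submodule L (V × L)}
    (hΓ : IsEquivariantGraph J Γ) (W : Submodule L V)
    (hW : ∀ g : Equiv.Perm Ψ, (∀ i ∈ J, g i = i) → ∀ w ∈ W, g • w ∈ W)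
    (hdisj : ∀ w ∈ W, ∀ y, (w, y) ∈ Γ → w = 0) :
    IsEquivariantGraph J (Γ ⊔ W.prod ⊥) := by
  refine ⟨fun y hy => ?_, fun g hg p hp => ?_⟩
  · obtain ⟨⟨w, a⟩, hwa, ⟨w', b⟩, ⟨hw', hb⟩, hadd⟩ := Submodule.mem_sup.1 hy
    have hb0 : b = 0 := (Submodule.mem_bot L).1 hb
    have h1 : w + w' = 0 := congrArg Prod.fst hadd
    have h2 : a + b = y := congrArg Prod.snd hadd
    have hwW : w ∈ W := by
      rw [eq_neg_of_add_eq_zero_left h1]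
      exact W.neg_mem hw'
    have hw0 := hdisj w hwW a hwa
    rw [hw0] at hwa
    rw [← h2, hb0, hΓ.single a hwa, add_zero]
  · obtain ⟨q, hq, ⟨w', b⟩, ⟨hw', hb⟩, rfl⟩ := Submodule.mem_sup.1 hp
    have hb0 : b = 0 := (Submodule.mem_bot L).1 hb
    rw [smul_add]
    refine add_mem (Submodule.mem_sup_left (hΓ.stable g hg q hq)) (Submodule.mem_sup_right ?_)
    refine ⟨hW g hg w' hw', ?_⟩
    change g • b = 0
    rw [hb0, smul_zero]

theorem smul_mem_span (hV : IsSmoothSemilinear (Ψ := Ψ) L V) (O : Set V) (g : Equiv.Perm Ψ)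
    (hO : ∀ u ∈ O, g • u ∈ O) {w : V} (hw : w ∈ Submodule.span L O) :
    g • w ∈ Submodule.span L O := by
  induction hw using Submodule.span_induction with
  | mem u hu => exact Submodule.subset_span (hO u hu)
  | zero => rw [smul_zero]; exact Submodule.zero_mem _
  | add u w _ _ hu hw => rw [smul_add]; exact Submodule.add_mem _ hu hw
  | smul a u _ hu => rw [hV.smul_smul]; exact Submodule.smul_mem _ _ hu

/-- The line through a fixed vector is stable, so it either misses the domain, and the extension is
by zero, or lies in it. -/
theorem IsEquivariantGraph.extend_fixed (hV : IsSmoothSemilinear (Ψ := Ψ) L V) {J : Finset Ψ}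
    {Γ : Submodule L (V × L)} (hΓ : IsEquivariantGraph J Γ) {v : V} (hv : Supp J v) :
    ∃ Γ' : Submodule L (V × L), IsEquivariantGraph J Γ' ∧ Γ ≤ Γ' ∧ ∃ y, (v, y) ∈ Γ' := by
  by_cases h : ∀ w ∈ Submodule.span L {v}, ∀ y, (w, y) ∈ Γ → w = 0
  · refine ⟨_, hΓ.sup_prod_bot _ (fun g hg w hw => smul_mem_span hV _ g ?_ hw) h, le_sup_left, 0,
      Submodule.mem_sup_right ⟨Submodule.mem_span_singleton_self v, Submodule.zero_mem _⟩⟩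
    rintro u rfl
    exact hv g hg
  · push Not at h
    obtain ⟨w, hw, y, hy, hw0⟩ := h
    obtain ⟨c, rfl⟩ := Submodule.mem_span_singleton.1 hw
    have hc : c ≠ 0 := by
      rintro rfl
      exact hw0 (zero_smul _ _)
    refine ⟨Γ, hΓ, le_rfl, c⁻¹ * y, ?_⟩
    have := Γ.smul_mem c⁻¹ hy
    rwa [Prod.smul_mk, smul_smul, inv_mul_cancel₀ hc, one_smul] at this

/-- `v` is invariant under the permutations fixing `J` pointwise and preserving `T`. -/
def IsBlock (J T : Finset Ψ) (v : V) : Prop :=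
  ∀ g : Equiv.Perm Ψ, (∀ i ∈ J, g i = i) → (∀ i ∈ T, g i ∈ T) → g • v = v

theorem IsBlock.smul [DecidableEq Ψ] {J T : Finset Ψ} {v : V} (hv : IsBlock J T v)
    {g : Equiv.Perm Ψ} (hg : ∀ i ∈ J, g i = i) : IsBlock J (T.image g) (g • v) := by
  intro h hh hT
  have h1 : (g⁻¹ * h * g) • v = v := by
    refine hv _ (fun i hi => ?_) fun i hi => ?_
    · rw [Equiv.Perm.mul_apply, Equiv.Perm.mul_apply, hg i hi, hh i hi,
        Equiv.Perm.inv_eq_iff_eq, hg i hi]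
    · obtain ⟨j, hj, hji⟩ := Finset.mem_image.1 (hT _ (Finset.mem_image_of_mem g hi))
      rw [Equiv.Perm.mul_apply, Equiv.Perm.mul_apply, ← hji]
      rwa [show g⁻¹ (g j) = j from g.symm_apply_apply j]
  rwa [mul_smul, mul_smul, inv_smul_eq_iff] at h1

theorem IsEquivariantGraph.extend_finset {J : Finset Ψ} (s : Finset V)
    (hs : ∀ u ∈ s, ∀ Γ : Submodule L (V × L), IsEquivariantGraph J Γ →
      ∃ Γ' : Submodule L (V × L), IsEquivariantGraph J Γ' ∧ Γ ≤ Γ' ∧ ∃ y, (u, y) ∈ Γ')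
    {Γ : Submodule L (V × L)} (hΓ : IsEquivariantGraph J Γ) :
    ∃ Γ' : Submodule L (V × L), IsEquivariantGraph J Γ' ∧ Γ ≤ Γ' ∧ ∀ u ∈ s, ∃ y, (u, y) ∈ Γ' := by
  classical
  induction s using Finset.induction_on with
  | empty => exact ⟨Γ, hΓ, le_rfl, by simp⟩
  | insert u s _ ih =>
    obtain ⟨Γ₁, h1, hle1, hs1⟩ := ih fun u hu => hs u (Finset.mem_insert_of_mem hu)
    obtain ⟨Γ₂, h2, hle2, y, hy⟩ := hs u (Finset.mem_insert_self _ _) Γ₁ h1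
    refine ⟨Γ₂, h2, hle1.trans hle2, fun w hw => ?_⟩
    rcases Finset.mem_insert.1 hw with rfl | hw
    · exact ⟨y, hy⟩
    · obtain ⟨z, hz⟩ := hs1 w hw
      exact ⟨z, hle2 hz⟩

/-- Induction on the block size, with `J` varying. If extension by zero is obstructed, a nonzero
combination of translates of `v` lies in the domain. Fixing more labels shrinks all blocks but one,
so the inductive hypothesis and this combination give a value on the last translate; descent then
restores equivariance over `J`. -/
theorem IsEquivariantGraph.extend_block [Infinite Ψ] (hξ : IsSymGenerated ξ)
    (hV : IsSmoothSemilinear (Ψ := Ψ) L V) {J : Finset Ψ} {Γ : Submodule L (V × L)}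
    (hΓ : IsEquivariantGraph J Γ) {T : Finset Ψ} (hTJ : Disjoint T J) {v : V}
    (hv : IsBlock J T v) :
    ∃ Γ' : Submodule L (V × L), IsEquivariantGraph J Γ' ∧ Γ ≤ Γ' ∧ ∃ y, (v, y) ∈ Γ' := by
  classical
  induction hn : T.card using Nat.strong_induction_on generalizing J Γ T v with
  | _ n ih =>
  let O : Set V := {u | ∃ g : Equiv.Perm Ψ, (∀ i ∈ J, g i = i) ∧ u = g • v}
  have hvO : v ∈ O := ⟨1, fun i _ => rfl, (one_smul _ v).symm⟩
  by_cases h : ∀ w ∈ Submodule.span L O, ∀ y, (w, y) ∈ Γ → w = 0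
  · refine ⟨_, hΓ.sup_prod_bot _ (fun g hg w hw => smul_mem_span hV _ g ?_ hw) h, le_sup_left, 0,
      Submodule.mem_sup_right ⟨Submodule.subset_span hvO, Submodule.zero_mem _⟩⟩
    rintro _ ⟨g', hg', rfl⟩
    exact ⟨g * g', fun i hi => by rw [Equiv.Perm.mul_apply, hg' i hi, hg i hi],
      (mul_smul g g' v).symm⟩
  push Not at h
  obtain ⟨w, hw, y, hy, hw0⟩ := h
  obtain ⟨c, hcO, hcw⟩ := Submodule.mem_span_set.1 hw
  have hγ : ∀ u ∈ c.support, ∃ g : Equiv.Perm Ψ, (∀ i ∈ J, g i = i) ∧ u = g • v :=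
    fun u hu => hcO hu
  choose! γ hγJ hγv using hγ
  obtain ⟨u₀, hu₀⟩ : c.support.Nonempty := by
    rw [Finsupp.support_nonempty_iff]
    rintro rfl
    exact hw0 (by rw [← hcw, Finsupp.sum_zero_index])
  let B : V → Finset Ψ := fun u => T.image (γ u)
  have hB : ∀ u ∈ c.support, IsBlock J (B u) u := fun u hu => by
    have := hv.smul (hγJ u hu)
    rwa [← hγv u hu] at this
  have hBcard : ∀ u, (B u).card = n := fun u => by
    rw [Finset.card_image_of_injective _ (γ u).injective, hn]
  have hBJ : ∀ u ∈ c.support, Disjoint (B u) J := fun u hu => by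
    rw [Finset.disjoint_left]
    intro i hi hiJ
    obtain ⟨j, hj, rfl⟩ := Finset.mem_image.1 hi
    have := (γ u).injective (hγJ u hu _ hiJ)
    rw [this] at hiJ
    exact Finset.disjoint_left.1 hTJ hj hiJ
  -- Leaving `B u₀` out keeps `u₀` supported off `J' \ J`, as descent requires, while every other
  -- block loses a label.
  let J' : Finset Ψ := J ∪ (c.support.biUnion B \ B u₀)
  have hJJ' : J ⊆ J' := Finset.subset_union_left
  have hne : ∀ u ∈ c.support.erase u₀, ∃ i ∈ B u, i ∈ J' := by
    intro u hu
    obtain ⟨huu₀, hu⟩ := Finset.mem_erase.1 hu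
    by_contra! hall
    have hsub : B u ⊆ B u₀ := fun i hi => by
      by_contra hi0
      exact hall i hi (Finset.mem_union_right _ (Finset.mem_sdiff.2
        ⟨Finset.mem_biUnion.2 ⟨u, hu, hi⟩, hi0⟩))
    -- A translate of `v` is determined by its block, so equal blocks would force `u = u₀`.
    have heq : B u = B u₀ := Finset.eq_of_subset_of_card_le hsub (by rw [hBcard, hBcard])
    apply huu₀
    rw [hγv u hu, hγv u₀ hu₀, ← inv_smul_eq_iff, ← mul_smul]
    refine hv _ (fun i hi => ?_) fun i hi => ?_
    · rw [Equiv.Perm.mul_apply, hγJ u hu i hi, Equiv.Perm.inv_eq_iff_eq, hγJ u₀ hu₀ i hi]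
    · have h1 : γ u i ∈ B u₀ := heq ▸ Finset.mem_image_of_mem _ hi
      obtain ⟨j, hj, hji⟩ := Finset.mem_image.1 h1
      rw [Equiv.Perm.mul_apply, ← hji]
      rwa [show (γ u₀)⁻¹ (γ u₀ j) = j from (γ u₀).symm_apply_apply j]
  obtain ⟨Γ₁, hΓ₁, hle₁, hdom⟩ := (hΓ.mono hJJ').extend_finset (c.support.erase u₀)
    (fun u hu Γ₀ hΓ₀ => by
      obtain ⟨i, hi, hiJ⟩ := hne u hu
      have huc := Finset.mem_of_mem_erase hu
      refine ih (B u \ J').card ?_ hΓ₀ Finset.sdiff_disjoint (v := u) (fun g hg hgB => ?_) rfl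
      · rw [← hBcard u]
        refine Finset.card_lt_card ⟨Finset.sdiff_subset, fun hsub => ?_⟩
        exact (Finset.mem_sdiff.1 (hsub hi)).2 hiJ
      · refine hB u huc g (fun i hi => hg i (hJJ' hi)) fun i hi => ?_
        by_cases hi' : i ∈ J'
        · rwa [hg i hi']
        · exact (Finset.mem_sdiff.1 (hgB i (Finset.mem_sdiff.2 ⟨hi, hi'⟩))).1)
  obtain ⟨y₀, hy₀⟩ : ∃ y₀, (u₀, y₀) ∈ Γ₁ := by
    let D : Submodule L V := Γ₁.map (LinearMap.fst L V L)
    have hD : ∀ {u}, u ∈ D ↔ ∃ y, (u, y) ∈ Γ₁ := by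
      intro u
      simp [D]
    rw [← hD]
    have hwD : w ∈ D := hD.2 ⟨y, hle₁ hy⟩
    -- The combination and all its other terms lie in the domain, hence so does `u₀`, its
    -- coefficient being invertible.
    rw [← hcw, Finsupp.sum, ← Finset.add_sum_erase _ _ hu₀] at hwD
    have hsum : ∑ u ∈ c.support.erase u₀, c u • u ∈ D :=
      D.sum_mem fun u hu => D.smul_mem _ (hD.2 (hdom u hu))
    have h1 := (D.add_mem_iff_left hsum).1 hwD
    exact (D.smul_mem_iff (Finsupp.mem_support_iff.1 hu₀)).1 h1
  obtain ⟨r, hr, -⟩ := hξ.exists_retraction (J' \ J)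
  obtain ⟨Γ', hΓ', hle', hdesc⟩ := hΓ.descend hξ hV hJJ' hΓ₁ hle₁ hr
  have hmem := hdesc (u₀, y₀) hy₀ (J ∪ B u₀) (fun g hg => hB u₀ hu₀ g
      (fun i hi => hg i (Finset.mem_union_left _ hi))
      (fun i hi => by rwa [hg i (Finset.mem_union_right _ hi)])) (by
    rw [Finset.disjoint_union_left]
    refine ⟨Finset.disjoint_sdiff, ?_⟩
    rw [Finset.disjoint_left]
    intro i hi hi'
    obtain ⟨h1, h2⟩ := Finset.mem_sdiff.1 hi'
    rcases Finset.mem_union.1 h1 with h1 | h1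
    · exact h2 h1
    · exact (Finset.mem_sdiff.1 h1).2 hi)
  refine ⟨Γ', hΓ', hle', (γ u₀)⁻¹ • r y₀, ?_⟩
  have h1 := hΓ'.stable (γ u₀)⁻¹ (fun i hi => by
    rw [Equiv.Perm.inv_eq_iff_eq, hγJ u₀ hu₀ i hi]) _ hmem
  have h2 : (γ u₀)⁻¹ • u₀ = v := by
    rw [inv_smul_eq_iff]
    exact hγv u₀ hu₀
  rw [Prod.smul_mk, h2] at h1
  exact h1

end Extension

end SmSym

/-! ### Block vectors span, and equivariant functionals extend to the whole space -/

namespace SmSym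

section Total

variable {Ψ A L V : Type*} [Field L] [MulSemiringAction (Equiv.Perm Ψ) L] {ξ : Ψ → A → L}
  [AddCommGroup V] [Module L V] [DistribMulAction (Equiv.Perm Ψ) V]

/-- Dedekind's independence of characters: permutations that differ on `J` restrict to distinct
embeddings of the subfield carried by `J`, thanks to `separated`. -/
theorem eq_zero_of_forall_sum_smul_eq_zero (hξ : IsSymGenerated ξ) {J : Finset Ψ} {ι : Type*}
    (s : Finset ι) (e : ι → Equiv.Perm Ψ)
    (he : ∀ a ∈ s, ∀ b ∈ s, (∀ i ∈ J, e a i = e b i) → a = b) (m : ι → L)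
    (h : ∀ c ∈ subfieldOn ξ (J : Set Ψ), ∑ a ∈ s, m a * (e a • c) = 0) :
    ∀ a ∈ s, m a = 0 := by
  let χ : s → (subfieldOn ξ (J : Set Ψ) →* L) := fun a =>
    ((MulSemiringAction.toRingHom _ L (e a)).comp (subfieldOn ξ (J : Set Ψ)).subtype : _ →* L)
  have hχ : Function.Injective χ := by
    intro a b hab
    obtain ⟨x, hx⟩ := hξ.separated
    refine Subtype.ext (he a a.2 b b.2 fun i hi => hx ?_)
    have h1 : e a • ξ i x = e b • ξ i x :=
      DFunLike.congr_fun hab ⟨ξ i x, mem_subfieldOn (S := (J : Set Ψ)) hi x⟩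
    rwa [hξ.smul, hξ.smul] at h1
  have hli := (linearIndependent_monoidHom (subfieldOn ξ (J : Set Ψ)) L).comp χ hχ
  rw [Fintype.linearIndependent_iff] at hli
  intro a ha
  refine hli (fun a => m a) (funext fun c => ?_) ⟨a, ha⟩
  rw [Finset.sum_apply, Pi.zero_apply, ← h c c.2, ← Finset.sum_coe_sort s]
  rfl

/-- For c with labels in `T`, the sum of τ(c v) over all permutations τ of `T` is a block vector. By
Dedekind the families (τ c)_τ span all functions on `Perm T`, so some combination of these sums
isolates the term τ = 1, which is `v`. -/
theorem mem_span_isBlock (hξ : IsSymGenerated ξ) (hV : IsSmoothSemilinear (Ψ := Ψ) L V)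
    [DecidableEq Ψ] {J T : Finset Ψ} {v : V} (hv : Supp (T ∪ J) v) :
    v ∈ Submodule.span L {w : V | IsBlock J T w} := by
  let e : Equiv.Perm T → Equiv.Perm Ψ := fun τ => Equiv.Perm.ofSubtype τ
  have he_mem : ∀ τ (i : Ψ) (hi : i ∈ T), e τ i = τ ⟨i, hi⟩ := fun τ i hi =>
    Equiv.Perm.ofSubtype_apply_of_mem τ hi
  have he_not : ∀ τ, ∀ i ∉ T, e τ i = i := fun τ i hi =>
    Equiv.Perm.ofSubtype_apply_of_not_mem τ hi
  let Λ : (Equiv.Perm T → L) →ₗ[L] V := ∑ τ, (LinearMap.proj τ).smulRight (e τ • v)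
  have hΛ : ∀ x, Λ x = ∑ τ, x τ • e τ • v := fun x => by simp [Λ]
  have hspan : Submodule.span L
      {x : Equiv.Perm T → L | ∃ c ∈ subfieldOn ξ (T : Set Ψ), x = fun τ => e τ • c} = ⊤ := by
    by_contra hne
    obtain ⟨f, hf0, hf⟩ := Submodule.exists_le_ker_of_lt_top _ (lt_top_iff_ne_top.2 hne)
    apply hf0
    have hsum : ∀ x, f x = ∑ τ, f (Pi.single τ 1) * x τ := fun x => by
      conv_lhs => rw [← Finset.univ_sum_single x]
      rw [map_sum]
      refine Finset.sum_congr rfl fun τ _ => ?_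
      have : Pi.single τ (x τ) = x τ • (Pi.single τ 1 : Equiv.Perm T → L) := by
        rw [← Pi.single_smul, smul_eq_mul, mul_one]
      rw [this, map_smul, smul_eq_mul, mul_comm]
    have hz := eq_zero_of_forall_sum_smul_eq_zero hξ (J := T) Finset.univ e (by
      intro τ _ τ' _ h
      ext i
      have := h i i.2
      rwa [he_mem _ _ i.2, he_mem _ _ i.2] at this) (fun τ => f (Pi.single τ 1)) (by
      intro c hc
      rw [← hsum fun τ => e τ • c]
      exact hf (Submodule.subset_span ⟨c, hc, rfl⟩))
    ext τ
    simpa using hz τ (Finset.mem_univ τ)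
  have hv' : v = Λ (Pi.single 1 1) := by
    rw [hΛ, Finset.sum_eq_single 1]
    · simp [e]
    · intro τ _ hτ
      simp [hτ]
    · simp
  rw [hv']
  have hmem : (Pi.single 1 1 : Equiv.Perm T → L) ∈ Submodule.span L
      {x : Equiv.Perm T → L | ∃ c ∈ subfieldOn ξ (T : Set Ψ), x = fun τ => e τ • c} :=
    hspan ▸ Submodule.mem_top
  have hmap := Submodule.mem_map_of_mem (f := Λ) hmem
  rw [Submodule.map_span] at hmap
  refine Submodule.span_mono ?_ hmap
  rintro _ ⟨_, ⟨c, hc, rfl⟩, rfl⟩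
  intro g hgJ hgT
  have himg : T.image g = T := Finset.eq_of_subset_of_card_le
    (fun i hi => by
      obtain ⟨j, hj, rfl⟩ := Finset.mem_image.1 hi
      exact hgT j hj) (by rw [Finset.card_image_of_injective _ g.injective])
  have hgiff : ∀ i, i ∈ T ↔ g i ∈ T := fun i => by
    refine ⟨hgT i, fun hi => ?_⟩
    rw [← himg] at hi
    obtain ⟨j, hj, hji⟩ := Finset.mem_image.1 hi
    rwa [← g.injective hji]
  let ρ : Equiv.Perm T := g.subtypePerm fun i => (hgiff i).symm
  have hcv : Supp (T ∪ J) (c • v) := fun h hh => by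
    rw [hV.smul_smul, hv h hh, hξ.supp hc h fun i hi => hh i (Finset.mem_union_left _ hi)]
  -- A permutation fixing `J` and preserving `T` merely permutes the summands, since it acts on `T ∪
  -- J` as the extension of its restriction ρ.
  have hterm : ∀ τ, g • ((e τ • c) • e τ • v) = (e (ρ * τ) • c) • e (ρ * τ) • v := fun τ => by
    rw [← hV.smul_smul, ← hV.smul_smul, ← mul_smul]
    refine hcv.smul_eq_smul fun i hi => ?_
    by_cases hiT : i ∈ T
    · rw [Equiv.Perm.mul_apply, he_mem _ _ hiT, he_mem _ _ hiT]
      rfl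
    · have hiJ := (Finset.mem_union.1 hi).resolve_left hiT
      rw [Equiv.Perm.mul_apply, he_not _ _ hiT, he_not _ _ hiT, hgJ i hiJ]
  rw [hΛ, Finset.smul_sum, Finset.sum_congr rfl fun τ _ => hterm τ]
  exact Equiv.sum_comp (Equiv.mulLeft ρ) fun τ => (e τ • c) • e τ • v

/-- In a finite `Ψ` there is no room for moving labels, but there `T` is taken to be the complement
of `J`; a block vector is then simply fixed by the stabilizer of `J`. -/
theorem IsEquivariantGraph.extend (hξ : IsSymGenerated ξ) (hV : IsSmoothSemilinear (Ψ := Ψ) L V)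
    {J T : Finset Ψ} {Γ : Submodule L (V × L)} (hΓ : IsEquivariantGraph J Γ)
    (hTJ : Disjoint T J) (hT : Infinite Ψ ∨ ∀ i, i ∉ J → i ∈ T) {v : V} (hv : IsBlock J T v) :
    ∃ Γ' : Submodule L (V × L), IsEquivariantGraph J Γ' ∧ Γ ≤ Γ' ∧ ∃ y, (v, y) ∈ Γ' := by
  rcases hT with hinf | hT
  · exact hΓ.extend_block hξ hV hTJ hv
  · refine hΓ.extend_fixed hV fun g hg => hv g hg fun i hi => hT _ fun h => ?_
    have h1 := g.injective (hg _ h)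
    rw [h1] at h
    exact Finset.disjoint_left.1 hTJ hi h

/-- Injectivity: every equivariant partial functional extends to an equivariant functional. -/
theorem IsEquivariantGraph.exists_linearMap (hξ : IsSymGenerated ξ)
    (hV : IsSmoothSemilinear (Ψ := Ψ) L V) {J : Finset Ψ} {Γ : Submodule L (V × L)}
    (hΓ : IsEquivariantGraph J Γ) :
    ∃ φ : V →ₗ[L] L, (∀ p ∈ Γ, φ p.1 = p.2) ∧
      ∀ g : Equiv.Perm Ψ, (∀ i ∈ J, g i = i) → ∀ v, φ (g • v) = g • φ v := by
  classical
  obtain ⟨Δ, hle, hmax⟩ := zorn_le_nonempty₀ {Δ : Submodule L (V × L) | IsEquivariantGraph J Δ}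
    (fun c hc hchain Δ hΔ => by
      have hmem : ∀ {p}, p ∈ sSup c ↔ ∃ Δ ∈ c, p ∈ Δ :=
        Submodule.mem_sSup_of_directed ⟨Δ, hΔ⟩ hchain.directedOn
      refine ⟨sSup c, ⟨fun y hy => ?_, fun g hg p hp => ?_⟩, fun Δ' h => le_sSup h⟩
      · obtain ⟨Δ', h1, h2⟩ := hmem.1 hy
        exact (hc h1).single y h2
      · obtain ⟨Δ', h1, h2⟩ := hmem.1 hp
        exact hmem.2 ⟨Δ', h1, (hc h1).stable g hg p h2⟩) Γ hΓ
  have hΔ : IsEquivariantGraph J Δ := hmax.prop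
  have htot : ∀ v, ∃ y, (v, y) ∈ Δ := by
    intro v
    obtain ⟨T, hTJ, hvT, hT⟩ : ∃ T : Finset Ψ, Disjoint T J ∧ Supp (T ∪ J) v ∧
        (Infinite Ψ ∨ ∀ i, i ∉ J → i ∈ T) := by
      rcases finite_or_infinite Ψ with hfin | hinf
      · have := Fintype.ofFinite Ψ
        refine ⟨Jᶜ, disjoint_compl_left, fun g hg => ?_, Or.inr fun i hi => by simpa using hi⟩
        have : g = 1 := by
          ext i
          exact hg i (by simp [em'])
        rw [this, one_smul]
      · obtain ⟨T, hT⟩ := hV.exists_supp v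
        refine ⟨T \ J, Finset.sdiff_disjoint, hT.mono fun i hi => ?_, Or.inl hinf⟩
        rw [Finset.sdiff_union_self_eq_union]
        exact Finset.mem_union_left _ hi
    have hsub : Submodule.span L {w : V | IsBlock J T w} ≤ Δ.map (LinearMap.fst L V L) := by
      refine Submodule.span_le.2 fun w hw => ?_
      obtain ⟨Δ', hΔ', hle', y, hy⟩ := hΔ.extend hξ hV hTJ hT hw
      exact ⟨(w, y), hmax.le_of_ge hΔ' hle' hy, rfl⟩
    obtain ⟨⟨v', y⟩, hy, rfl⟩ := hsub (mem_span_isBlock hξ hV hvT)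
    exact ⟨y, hy⟩
  choose φ hφ using htot
  have huniq : ∀ {v y}, (v, y) ∈ Δ → φ v = y := fun {v y} h => by
    have h1 := Δ.sub_mem (hφ v) h
    rw [Prod.mk_sub_mk, sub_self] at h1
    exact sub_eq_zero.1 (hΔ.single _ h1)
  refine ⟨{ toFun := φ
            map_add' := fun v w => huniq (Δ.add_mem (hφ v) (hφ w))
            map_smul' := fun c v => huniq (Δ.smul_mem c (hφ v)) }, fun p hp => huniq (hle hp), ?_⟩
  exact fun g hg v => huniq (hΔ.stable g hg _ (hφ v))

end Total

end SmSym

/-! ### Equivariant functionals separate points -/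

namespace SmSym

section Cogenerator

variable {Ψ A L V : Type*} [Field L] [MulSemiringAction (Equiv.Perm Ψ) L] {ξ : Ψ → A → L}
  [AddCommGroup V] [Module L V] [DistribMulAction (Equiv.Perm Ψ) V]

/-- The functional `φ` is equivariant under the permutations fixing `J` pointwise. -/
def IsEquivariantOver (J : Finset Ψ) (φ : V →ₗ[L] L) : Prop :=
  ∀ g : Equiv.Perm Ψ, (∀ i ∈ J, g i = i) → ∀ v, φ (g • v) = g • φ v

/-- Descend y • φ from `J` to `J ∩ T`, starting from the zero partial functional. The factor y,
supported in `J \ T`, preserves `J`-equivariance and is chosen so that the retraction does not kill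
the value at `w`. -/
theorem exists_isEquivariantOver_inter [Infinite Ψ] [DecidableEq Ψ] (hξ : IsSymGenerated ξ)
    (hV : IsSmoothSemilinear (Ψ := Ψ) L V) {J T : Finset Ψ} {φ : V →ₗ[L] L}
    (hφ : IsEquivariantOver J φ) {w : V} (hT : Supp T w) (hw : φ w ≠ 0) :
    ∃ φ' : V →ₗ[L] L, IsEquivariantOver (J ∩ T) φ' ∧ φ' w ≠ 0 := by
  obtain ⟨r, hr, hnd⟩ := hξ.exists_retraction (J \ (J ∩ T))
  obtain ⟨y, hy, hry⟩ := hnd (φ w) hw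
  have hyJ : Supp J y := hy.mono Finset.sdiff_subset
  have hbot : IsEquivariantGraph (J ∩ T) (⊥ : Submodule L (V × L)) :=
    ⟨fun y hy => congrArg Prod.snd ((Submodule.mem_bot L).1 hy), fun g _ p hp => by
      rw [(Submodule.mem_bot L).1 hp, smul_zero]
      exact Submodule.zero_mem _⟩
  have hgraph : IsEquivariantGraph J (y • φ).graph := by
    refine ⟨fun z hz => ?_, fun g hg p hp => ?_⟩
    · rw [LinearMap.mem_graph_iff] at hz
      simpa using hz
    · rw [LinearMap.mem_graph_iff] at hp ⊢
      change g • p.2 = y * φ (g • p.1)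
      rw [hp, hφ g hg, LinearMap.smul_apply, smul_eq_mul, smul_mul', hyJ g hg]
  obtain ⟨Γ, hΓ, -, hdesc⟩ := hbot.descend hξ hV Finset.inter_subset_left hgraph bot_le hr
  have hmem := hdesc (w, φ w * y) ((LinearMap.mem_graph_iff _ _).2 (by simp [mul_comm])) T hT (by
    rw [Finset.disjoint_left]
    intro i hi hi'
    obtain ⟨h1, h2⟩ := Finset.mem_sdiff.1 hi'
    exact h2 (Finset.mem_inter.2 ⟨h1, hi⟩))
  obtain ⟨φ', hφ'Γ, hφ'⟩ := hΓ.exists_linearMap hξ hV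
  refine ⟨φ', hφ', ?_⟩
  rw [hφ'Γ _ hmem]
  exact hry

theorem finite_embeddings {J T : Finset Ψ} : {e : J ↪ Ψ | ∀ j, e j ∈ T}.Finite := by
  let f : {e : J ↪ Ψ | ∀ j, e j ∈ T} → (J → T) := fun e j => ⟨e.1 j, e.2 j⟩
  have hf : Function.Injective f := by
    intro e e' h
    refine Subtype.ext (DFunLike.ext _ _ fun j => ?_)
    exact congrArg Subtype.val (congrFun h j)
  exact Set.finite_coe_iff.1 (Finite.of_injective f hf)

/-- The translate of the functional `c • φ`. -/
def translate (c : L) (φ : V →ₗ[L] L) (g : Equiv.Perm Ψ) (w : V) : L := g • (c * φ (g⁻¹ • w))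

theorem translate_add (c : L) (φ : V →ₗ[L] L) (g : Equiv.Perm Ψ) (w w' : V) :
    translate c φ g (w + w') = translate c φ g w + translate c φ g w' := by
  rw [translate, smul_add, map_add, mul_add, smul_add]
  rfl

theorem translate_smul (hV : IsSmoothSemilinear (Ψ := Ψ) L V) (c : L) (φ : V →ₗ[L] L)
    (g : Equiv.Perm Ψ) (a : L) (w : V) :
    translate c φ g (a • w) = a * translate c φ g w := by
  rw [translate, hV.smul_smul, map_smul, smul_eq_mul, mul_left_comm, smul_mul', smul_inv_smul]
  rfl

theorem smul_translate (c : L) (φ : V →ₗ[L] L) (g h : Equiv.Perm Ψ) (w : V) :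
    h • translate c φ g w = translate c φ (h * g) (h • w) := by
  rw [translate, translate, mul_inv_rev, mul_smul, mul_smul, inv_smul_smul]

theorem translate_congr {J : Finset Ψ} {c : L} (hc : Supp J c) {φ : V →ₗ[L] L}
    (hφ : IsEquivariantOver J φ) {g h : Equiv.Perm Ψ} (hgh : ∀ i ∈ J, g i = h i) (w : V) :
    translate c φ g w = translate c φ h w := by
  obtain ⟨k, rfl⟩ : ∃ k, h = g * k := ⟨g⁻¹ * h, by group⟩
  have hk : ∀ i ∈ J, k i = i := fun i hi => g.injective (hgh i hi).symm
  have h1 := hφ k hk (k⁻¹ • g⁻¹ • w)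
  rw [smul_inv_smul] at h1
  rw [translate, translate, mul_inv_rev, mul_smul, mul_smul, smul_mul' k, hc k hk, ← h1]

/-- Sum the translates of c • φ over the cosets of the stabilizer of `J`, that is, over embeddings
`J ↪ Ψ`; `G` picks representatives. The sum is defined on `M` by `hfin`, and injectivity extends it
to `V`. -/
theorem exists_equivariant_of_finite_support (hξ : IsSymGenerated ξ)
    (hV : IsSmoothSemilinear (Ψ := Ψ) L V) {J : Finset Ψ} {φ : V →ₗ[L] L}
    (hφ : IsEquivariantOver J φ) (M : Submodule L V)
    (hM : ∀ g : Equiv.Perm Ψ, ∀ w ∈ M, g • w ∈ M) (G : (J ↪ Ψ) → Equiv.Perm Ψ)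
    (hG : ∀ e (j : J), G e j = e j)
    (hfin : ∀ w ∈ M, {e | φ ((G e)⁻¹ • w) ≠ 0}.Finite) {w : V} (hw : w ∈ M) (hφw : φ w ≠ 0) :
    ∃ Φ : V →ₗ[L] L, IsEquivariantOver (∅ : Finset Ψ) Φ ∧ Φ w ≠ 0 := by
  have hsupp : ∀ c, ∀ w ∈ M, (Function.support fun e => translate c φ (G e) w).Finite := by
    intro c w hw
    refine (hfin w hw).subset fun e he h0 => he ?_
    change translate c φ (G e) w = 0
    rw [translate, h0, mul_zero, smul_zero]
  -- If every twist c gave zero at `w`, Dedekind would kill each coefficient, including the nonzero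
  -- one at the inclusion of `J`.
  obtain ⟨c, hc, hcw⟩ : ∃ c ∈ subfieldOn ξ (J : Set Ψ), ∑ᶠ e, translate c φ (G e) w ≠ 0 := by
    by_contra! hall
    let s := (hfin w hw).toFinset
    have h0 := eq_zero_of_forall_sum_smul_eq_zero hξ (J := J) s G (by
      intro e _ e' _ h
      refine DFunLike.ext _ _ fun j => ?_
      rw [← hG, ← hG]
      exact h j j.2) (fun e => G e • φ ((G e)⁻¹ • w)) (by
      intro c hc
      rw [← hall c hc, finsum_eq_sum_of_support_subset (s := s)]
      · refine Finset.sum_congr rfl fun e _ => ?_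
        rw [translate, smul_mul', mul_comm]
      · intro e he
        rw [Set.Finite.coe_toFinset]
        intro h0
        refine he ?_
        change translate c φ (G e) w = 0
        rw [translate, h0, mul_zero, smul_zero])
    let e₀ : J ↪ Ψ := Function.Embedding.subtype _
    have h1 : φ ((G e₀)⁻¹ • w) ≠ 0 := by
      rw [hφ _ fun i hi => ?_]
      · exact fun h => hφw ((smul_eq_zero_iff_eq _).1 h)
      · rw [Equiv.Perm.inv_eq_iff_eq]
        exact (hG e₀ ⟨i, hi⟩).symm
    exact h1 ((smul_eq_zero_iff_eq _).1 (h0 e₀ ((hfin w hw).mem_toFinset.2 h1)))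
  let Γ : Submodule L (V × L) :=
    { carrier := {p | p.1 ∈ M ∧ p.2 = ∑ᶠ e, translate c φ (G e) p.1}
      add_mem' := by
        rintro p q ⟨hp, hp2⟩ ⟨hq, hq2⟩
        refine ⟨M.add_mem hp hq, ?_⟩
        rw [Prod.snd_add, hp2, hq2, ← finsum_add_distrib (hsupp c _ hp) (hsupp c _ hq)]
        exact finsum_congr fun e => (translate_add ..).symm
      zero_mem' := ⟨M.zero_mem, by simp [translate]⟩
      smul_mem' := by
        rintro a p ⟨hp, hp2⟩
        refine ⟨M.smul_mem a hp, ?_⟩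
        rw [Prod.smul_snd, hp2, smul_finsum]
        exact finsum_congr fun e => (translate_smul hV ..).symm }
  have hΓ : IsEquivariantGraph (∅ : Finset Ψ) Γ := by
    refine ⟨fun y hy => ?_, fun g _ p hp => ⟨hM g _ hp.1, ?_⟩⟩
    · rw [show y = _ from hy.2]
      simp [translate]
    · have h1 : g • p.2 = ∑ᶠ e, g • translate c φ (G e) p.1 := by
        rw [show p.2 = _ from hp.2]
        exact AddEquiv.map_finsum (DistribMulAction.toAddEquiv L g) _
      -- A permutation g reindexes the sum by e ↦ g ∘ e; representatives of the same coset give the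
      -- same translate.
      rw [Prod.smul_snd, h1,
        ← finsum_comp_equiv (Equiv.embeddingCongr (Equiv.refl J) g)
          (f := fun e => translate c φ (G e) (g • p).1)]
      refine finsum_congr fun e => ?_
      rw [smul_translate, Prod.smul_fst]
      refine translate_congr (hξ.supp hc) hφ (fun i hi => ?_) _
      rw [Equiv.Perm.mul_apply, hG e ⟨i, hi⟩, hG _ ⟨i, hi⟩]
      rfl
  obtain ⟨Φ, hΦΓ, hΦ⟩ := hΓ.exists_linearMap hξ hV
  refine ⟨Φ, hΦ, ?_⟩
  rw [hΦΓ (w, ∑ᶠ e, translate c φ (G e) w) ⟨hw, rfl⟩]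
  exact hcw

/-- The cogenerator property: equivariant functionals separate points. -/
theorem exists_equivariant_ne_zero (hξ : IsSymGenerated ξ)
    (hV : IsSmoothSemilinear (Ψ := Ψ) L V) {v : V} (hv : v ≠ 0) :
    ∃ φ : V →ₗ[L] L, IsEquivariantOver (∅ : Finset Ψ) φ ∧ φ v ≠ 0 := by
  classical
  let M : Submodule L V := Submodule.span L {u | ∃ g : Equiv.Perm Ψ, u = g • v}
  have hvM : v ∈ M := Submodule.subset_span ⟨1, (one_smul _ v).symm⟩
  have hM : ∀ g : Equiv.Perm Ψ, ∀ w ∈ M, g • w ∈ M := fun g w hw =>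
    smul_mem_span hV _ g (by
      rintro _ ⟨h, rfl⟩
      exact ⟨g * h, (mul_smul g h v).symm⟩) hw
  let Q : Set (Finset Ψ) := {J | ∃ φ : V →ₗ[L] L, IsEquivariantOver J φ ∧ ∃ w ∈ M, φ w ≠ 0}
  have hQ : Q.Nonempty := by
    obtain ⟨J, hJ⟩ := hV.exists_supp v
    have hΓ : IsEquivariantGraph J (Submodule.span L {((v, 1) : V × L)}) := by
      refine ⟨fun y hy => ?_, fun g hg p hp => ?_⟩
      · obtain ⟨a, ha⟩ := Submodule.mem_span_singleton.1 hy
        rw [Prod.smul_mk, Prod.mk.injEq] at ha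
        rw [← ha.2, (smul_eq_zero.1 ha.1).resolve_right hv, zero_smul]
      · obtain ⟨a, rfl⟩ := Submodule.mem_span_singleton.1 hp
        refine Submodule.mem_span_singleton.2 ⟨g • a, ?_⟩
        refine Prod.ext ?_ ?_
        · change (g • a) • v = g • a • v
          rw [hV.smul_smul, hJ g hg]
        · change (g • a) * 1 = g • (a * 1)
          rw [mul_one, mul_one]
    obtain ⟨φ, hφΓ, hφ⟩ := hΓ.exists_linearMap hξ hV
    refine ⟨J, φ, hφ, v, hvM, ?_⟩
    rw [hφΓ (v, 1) (Submodule.mem_span_singleton_self _)]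
    exact one_ne_zero
  -- Minimality of |J| is what makes the sum of translates locally finite.
  obtain ⟨J, ⟨φ, hφ, w, hw, hφw⟩, hmin⟩ := (measure Finset.card).wf.has_min Q hQ
  have hext : ∀ e : J ↪ Ψ, ∃ g : Equiv.Perm Ψ, ∀ j : J, g j = e j := fun e => by
    obtain ⟨g, hg⟩ := exists_perm_extending J
      (f := fun i => if h : i ∈ J then e ⟨i, h⟩ else i) (by
        intro i hi j hj hij
        simp only [Finset.mem_coe] at hi hj
        simp only [hi, hj, dif_pos] at hij
        exact congrArg Subtype.val (e.injective hij))
    exact ⟨g, fun j => by rw [hg j j.2, dif_pos j.2]⟩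
  choose G hG using hext
  obtain ⟨Φ, hΦ, hΦw⟩ := exists_equivariant_of_finite_support hξ hV hφ M hM G hG (by
    intro u hu
    rcases finite_or_infinite Ψ with hfin | hinf
    · exact Set.toFinite _
    · obtain ⟨T, hT⟩ := hV.exists_supp u
      refine (finite_embeddings (J := J) (T := T)).subset fun e he j => ?_
      have hT' := hT.smul (G e)⁻¹
      obtain ⟨φ', hφ', hne⟩ := exists_isEquivariantOver_inter hξ hV hφ hT' he
      -- A nonzero translate at u forces all of `J` into the moved support, so e takes values in the
      -- finite set `T`.
      have h1 : ¬ (J ∩ T.image ⇑(G e)⁻¹).card < J.card :=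
        hmin _ ⟨φ', hφ', _, hM _ u hu, hne⟩
      have h2 := Finset.eq_of_subset_of_card_le Finset.inter_subset_left (not_lt.1 h1)
      have h3 : (j : Ψ) ∈ T.image ⇑(G e)⁻¹ :=
        (Finset.inter_eq_left.1 h2) j.2
      obtain ⟨t, ht, htj⟩ := Finset.mem_image.1 h3
      rw [Equiv.Perm.inv_eq_iff_eq] at htj
      rw [← hG, ← htj]
      exact ht) hw hφw
  refine ⟨Φ, hΦ, fun h0 => hΦw ?_⟩
  -- `M` is generated by the orbit of `v`, so an equivariant functional vanishing at `v` vanishes on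
  -- `M`.
  have hle : M ≤ LinearMap.ker Φ := by
    refine Submodule.span_le.2 ?_
    rintro _ ⟨g, rfl⟩
    change Φ (g • v) = 0
    rw [hΦ g (by simp), h0, smul_zero]
  exact hle hw

end Cogenerator

end SmSym

/-! ### Base change from an invariant subfield -/

namespace SmSym

open scoped TensorProduct

section BaseChange

variable {Ψ A K L X V : Type*} [Field L] [MulSemiringAction (Equiv.Perm Ψ) L] {ξ : Ψ → A → L}
  [Field K] [MulSemiringAction (Equiv.Perm Ψ) K] [Algebra K L]
  [AddCommGroup X] [Module K X] [DistribMulAction (Equiv.Perm Ψ) X]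
  [AddCommGroup V] [Module K V] [DistribMulAction (Equiv.Perm Ψ) V]

/-- The diagonal action of a permutation on the base change of a semilinear representation. -/
def baseChangeHom
    (hKL : ∀ (g : Equiv.Perm Ψ) (a : K), g • algebraMap K L a = algebraMap K L (g • a))
    (hV : IsSmoothSemilinear (Ψ := Ψ) K V) (g : Equiv.Perm Ψ) : L ⊗[K] V →+ L ⊗[K] V :=
  TensorProduct.liftAddHom
    { toFun := fun a =>
        { toFun := fun v => (g • a) ⊗ₜ (g • v)
          map_zero' := by rw [smul_zero, TensorProduct.tmul_zero]
          map_add' := fun v w => by rw [smul_add, TensorProduct.tmul_add] }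
      map_zero' := by
        ext v
        change (g • (0 : L)) ⊗ₜ[K] (g • v) = 0
        rw [smul_zero, TensorProduct.zero_tmul]
      map_add' := fun a b => by
        ext v
        change (g • (a + b)) ⊗ₜ[K] (g • v) = (g • a) ⊗ₜ (g • v) + (g • b) ⊗ₜ (g • v)
        rw [smul_add, TensorProduct.add_tmul] }
    (fun c a v => by
      change (g • (c • a)) ⊗ₜ[K] (g • v) = (g • a) ⊗ₜ (g • (c • v))
      rw [Algebra.smul_def, smul_mul', hKL, hV.smul_smul, ← Algebra.smul_def,
        TensorProduct.smul_tmul])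

theorem baseChangeHom_tmul
    (hKL : ∀ (g : Equiv.Perm Ψ) (a : K), g • algebraMap K L a = algebraMap K L (g • a))
    (hV : IsSmoothSemilinear (Ψ := Ψ) K V) (g : Equiv.Perm Ψ) (a : L) (v : V) :
    baseChangeHom hKL hV g (a ⊗ₜ v) = (g • a) ⊗ₜ (g • v) := rfl

/-- The base change of a semilinear representation. -/
@[reducible]
def baseChangeAction
    (hKL : ∀ (g : Equiv.Perm Ψ) (a : K), g • algebraMap K L a = algebraMap K L (g • a))
    (hV : IsSmoothSemilinear (Ψ := Ψ) K V) : DistribMulAction (Equiv.Perm Ψ) (L ⊗[K] V) where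
  smul g x := baseChangeHom hKL hV g x
  one_smul x := by
    change baseChangeHom hKL hV 1 x = x
    induction x using TensorProduct.induction_on with
    | zero => rw [map_zero]
    | tmul a v => rw [baseChangeHom_tmul, one_smul, one_smul]
    | add x y hx hy => rw [map_add, hx, hy]
  mul_smul g h x := by
    change baseChangeHom hKL hV (g * h) x = baseChangeHom hKL hV g (baseChangeHom hKL hV h x)
    induction x using TensorProduct.induction_on with
    | zero => rw [map_zero, map_zero, map_zero]
    | tmul a v => rw [baseChangeHom_tmul, baseChangeHom_tmul, baseChangeHom_tmul, mul_smul,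
        mul_smul]
    | add x y hx hy => rw [map_add, map_add, map_add, hx, hy]
  smul_zero g := map_zero (baseChangeHom hKL hV g)
  smul_add g := map_add (baseChangeHom hKL hV g)

theorem isSmoothSemilinear_baseChange (hξ : IsSymGenerated ξ)
    (hKL : ∀ (g : Equiv.Perm Ψ) (a : K), g • algebraMap K L a = algebraMap K L (g • a))
    (hV : IsSmoothSemilinear (Ψ := Ψ) K V) :
    letI := baseChangeAction (L := L) hKL hV
    IsSmoothSemilinear (Ψ := Ψ) L (L ⊗[K] V) := by
  classical
  let := baseChangeAction (L := L) hKL hV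
  refine ⟨fun g a x => ?_, fun x => ?_⟩
  · change baseChangeHom hKL hV g (a • x) = (g • a) • baseChangeHom hKL hV g x
    induction x using TensorProduct.induction_on with
    | zero => rw [smul_zero, map_zero, smul_zero]
    | tmul b v =>
      rw [TensorProduct.smul_tmul', baseChangeHom_tmul, baseChangeHom_tmul,
        TensorProduct.smul_tmul', smul_eq_mul, smul_eq_mul, smul_mul']
    | add x y hx hy => rw [smul_add, map_add, map_add, smul_add, hx, hy]
  · induction x using TensorProduct.induction_on with
    | zero => exact ⟨∅, fun g _ => smul_zero g⟩
    | tmul b v =>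
      obtain ⟨T, hT⟩ := hξ.exists_finset_mem b
      obtain ⟨U, hU⟩ := hV.exists_supp v
      refine ⟨T ∪ U, fun g hg => ?_⟩
      change baseChangeHom hKL hV g (b ⊗ₜ v) = b ⊗ₜ v
      rw [baseChangeHom_tmul, (hξ.supp hT).mono Finset.subset_union_left g hg,
        hU.mono Finset.subset_union_right g hg]
    | add x y hx hy =>
      obtain ⟨T, hT⟩ := hx
      obtain ⟨U, hU⟩ := hy
      refine ⟨T ∪ U, fun g hg => ?_⟩
      rw [smul_add, hT.mono Finset.subset_union_left g hg, hU.mono Finset.subset_union_right g hg]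

/-- Equivariant `K`-linear functionals with values in `L` extend along injections. -/
theorem exists_extension_over (hξ : IsSymGenerated ξ)
    (hKL : ∀ (g : Equiv.Perm Ψ) (a : K), g • algebraMap K L a = algebraMap K L (g • a))
    (hX : IsSmoothSemilinear (Ψ := Ψ) K X) (hV : IsSmoothSemilinear (Ψ := Ψ) K V)
    (i : X →ₗ[K] V) (hi : Function.Injective i) (hig : ∀ (g : Equiv.Perm Ψ) x, i (g • x) = g • i x)
    (f : X →ₗ[K] L) (hf : ∀ (g : Equiv.Perm Ψ) x, f (g • x) = g • f x) :
    ∃ ψ : V →ₗ[K] L, (∀ (g : Equiv.Perm Ψ) v, ψ (g • v) = g • ψ v) ∧ ∀ x, ψ (i x) = f x := by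
  let := baseChangeAction (L := L) hKL hV
  let F : L ⊗[K] X →ₗ[L] L := LinearMap.liftBaseChange L f
  have hF : ∀ (a : L) (x : X), F (a ⊗ₜ x) = a * f x := fun a x => by simp [F]
  let I : L ⊗[K] X →ₗ[L] L ⊗[K] V := i.baseChange L
  have hI : Function.Injective I := Module.Flat.lTensor_preserves_injective_linearMap i hi
  have hFg : ∀ (g : Equiv.Perm Ψ) x, F (baseChangeHom hKL hX g x) = g • F x := fun g x => by
    induction x using TensorProduct.induction_on with
    | zero => rw [map_zero, map_zero, smul_zero]
    | tmul a v => rw [baseChangeHom_tmul, hF, hF, hf, smul_mul']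
    | add x y hx hy => rw [map_add, map_add, map_add, smul_add, hx, hy]
  have hIg : ∀ (g : Equiv.Perm Ψ) x, I (baseChangeHom hKL hX g x) = baseChangeHom hKL hV g (I x) :=
    fun g x => by
    induction x using TensorProduct.induction_on with
    | zero => rw [map_zero, map_zero, map_zero]
    | tmul a v =>
      rw [baseChangeHom_tmul, LinearMap.baseChange_tmul, LinearMap.baseChange_tmul,
        baseChangeHom_tmul, hig]
    | add x y hx hy => rw [map_add, map_add, map_add, map_add, hx, hy]
  -- The base-changed functional, seen as a partial functional on L ⊗ V; flatness makes it
  -- single-valued.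
  have hΓ : IsEquivariantGraph (∅ : Finset Ψ) (LinearMap.range (I.prod F)) := by
    refine ⟨?_, ?_⟩
    · rintro y ⟨x, hx⟩
      have h1 : I x = 0 := congrArg Prod.fst hx
      have h2 : F x = y := congrArg Prod.snd hx
      rw [← h2, hI (h1.trans (map_zero I).symm), map_zero]
    · rintro g - _ ⟨x, rfl⟩
      exact ⟨baseChangeHom hKL hX g x, Prod.ext (hIg g x) (hFg g x)⟩
  obtain ⟨φ, hφΓ, hφ⟩ := hΓ.exists_linearMap hξ (isSmoothSemilinear_baseChange hξ hKL hV)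
  refine ⟨(φ.restrictScalars K).comp (TensorProduct.mk K L V 1), fun g v => ?_, fun x => ?_⟩
  · have h1 := hφ g (by simp) (1 ⊗ₜ v)
    have h2 : g • ((1 : L) ⊗ₜ[K] v) = (1 : L) ⊗ₜ (g • v) := by
      change baseChangeHom hKL hV g (1 ⊗ₜ v) = _
      rw [baseChangeHom_tmul, smul_one]
    rw [h2] at h1
    exact h1
  · have h1 := hφΓ _ ⟨1 ⊗ₜ x, rfl⟩
    change φ (I (1 ⊗ₜ x)) = F (1 ⊗ₜ x) at h1
    rw [hF, one_mul] at h1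
    exact h1

/-- Equivariant `K`-linear functionals with values in `L` separate points. -/
theorem exists_ne_zero_over (hξ : IsSymGenerated ξ)
    (hKL : ∀ (g : Equiv.Perm Ψ) (a : K), g • algebraMap K L a = algebraMap K L (g • a))
    (hV : IsSmoothSemilinear (Ψ := Ψ) K V) {v : V} (hv : v ≠ 0) :
    ∃ ψ : V →ₗ[K] L, (∀ (g : Equiv.Perm Ψ) v, ψ (g • v) = g • ψ v) ∧ ψ v ≠ 0 := by
  let := baseChangeAction (L := L) hKL hV
  have hne : (1 : L) ⊗ₜ[K] v ≠ 0 := fun h => hv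
    (Module.FaithfullyFlat.tensorProduct_mk_injective (A := K) (B := L) V
      (h.trans (TensorProduct.tmul_zero _ _).symm))
  obtain ⟨φ, hφ, hφv⟩ := exists_equivariant_ne_zero hξ (isSmoothSemilinear_baseChange hξ hKL hV) hne
  refine ⟨(φ.restrictScalars K).comp (TensorProduct.mk K L V 1), fun g v => ?_, hφv⟩
  have h1 := hφ g (by simp) (1 ⊗ₜ v)
  have h2 : g • ((1 : L) ⊗ₜ[K] v) = (1 : L) ⊗ₜ (g • v) := by
    change baseChangeHom hKL hV g (1 ⊗ₜ v) = _
    rw [baseChangeHom_tmul, smul_one]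
  rw [h2] at h1
  exact h1

end BaseChange

end SmSym

/-! ### Passage to modules over the skew group ring -/

namespace SmSym

noncomputable section

section SkewModule

variable {Ψ A K L X V : Type*} [Field L] [MulSemiringAction (Equiv.Perm Ψ) L] {ξ : Ψ → A → L}
  [Field K] [MulSemiringAction (Equiv.Perm Ψ) K] [Algebra K L]

variable (K Ψ) in
/-- The coefficients as a subring of the skew group ring. -/
def coeffHom : K →+* SkewMonoidAlgebra K (Equiv.Perm Ψ) where
  toFun a := SkewMonoidAlgebra.single 1 a
  map_one' := rfl
  map_mul' a b := by rw [SkewMonoidAlgebra.single_mul_single, one_smul, one_mul]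
  map_zero' := SkewMonoidAlgebra.single_zero _
  map_add' a b := SkewMonoidAlgebra.single_add _ _ _

variable [AddCommGroup X] [Module (SkewMonoidAlgebra K (Equiv.Perm Ψ)) X]
  [AddCommGroup V] [Module (SkewMonoidAlgebra K (Equiv.Perm Ψ)) V]

variable (K Ψ V) in
/-- The coefficient action on a module over the skew group ring. -/
@[reducible]
def coeffModule : Module K V := Module.compHom V (coeffHom Ψ K)

variable (K Ψ V) in
/-- The group action on a module over the skew group ring. -/
@[reducible]
def permAction : DistribMulAction (Equiv.Perm Ψ) V :=
  DistribMulAction.compHom V (SkewMonoidAlgebra.of K (Equiv.Perm Ψ))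

theorem single_smul_eq (g : Equiv.Perm Ψ) (a : K) (v : V) :
    SkewMonoidAlgebra.single g a • v =
      SkewMonoidAlgebra.single (1 : Equiv.Perm Ψ) a • SkewMonoidAlgebra.single g (1 : K) • v := by
  rw [smul_smul, SkewMonoidAlgebra.single_mul_single, one_smul, one_mul, mul_one]

variable (K Ψ V) in
/-- Every vector is supported by a finite set. -/
def IsSmoothModule : Prop :=
  ∀ v : V, ∃ T : Finset Ψ, ∀ g : Equiv.Perm Ψ, (∀ i ∈ T, g i = i) →
    SkewMonoidAlgebra.single g (1 : K) • v = v

theorem IsSmoothModule.isSmoothSemilinear (hV : IsSmoothModule Ψ K V) :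
    letI := coeffModule Ψ K V
    letI := permAction Ψ K V
    IsSmoothSemilinear (Ψ := Ψ) K V := by
  let := coeffModule Ψ K V
  let := permAction Ψ K V
  refine ⟨fun g a v => ?_, hV⟩
  change SkewMonoidAlgebra.single g (1 : K) • SkewMonoidAlgebra.single (1 : Equiv.Perm Ψ) a • v =
    SkewMonoidAlgebra.single (1 : Equiv.Perm Ψ) (g • a) • SkewMonoidAlgebra.single g (1 : K) • v
  rw [smul_smul, SkewMonoidAlgebra.single_mul_single, smul_smul,
    SkewMonoidAlgebra.single_mul_single, one_smul, one_mul, mul_one, one_mul, mul_one]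

/-- An additive map compatible with homogeneous elements is linear over the skew group ring. -/
def skewLinearMap (f : X →+ V)
    (h : ∀ (g : Equiv.Perm Ψ) (a : K) (x : X),
      f (SkewMonoidAlgebra.single g a • x) = SkewMonoidAlgebra.single g a • f x) :
    X →ₗ[SkewMonoidAlgebra K (Equiv.Perm Ψ)] V where
  __ := f
  map_smul' r x := by
    change f (r • x) = r • f x
    induction r using SkewMonoidAlgebra.induction_on with
    | zero => rw [zero_smul, zero_smul, map_zero]
    | single g a => exact h g a x
    | add r s hr hs => rw [add_smul, add_smul, map_add, hr, hs]

variable [Module (SkewMonoidAlgebra K (Equiv.Perm Ψ)) L]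

theorem exists_skew_extension (hξ : IsSymGenerated ξ)
    (hKL : ∀ (g : Equiv.Perm Ψ) (a : K), g • algebraMap K L a = algebraMap K L (g • a))
    (hL : ∀ (g : Equiv.Perm Ψ) (a : K) (m : L),
      SkewMonoidAlgebra.single g a • m = algebraMap K L a * (g • m))
    (hX : IsSmoothModule Ψ K X) (hV : IsSmoothModule Ψ K V)
    (i : X →ₗ[SkewMonoidAlgebra K (Equiv.Perm Ψ)] V) (hi : Function.Injective i)
    (f : X →ₗ[SkewMonoidAlgebra K (Equiv.Perm Ψ)] L) :
    ∃ ψ : V →ₗ[SkewMonoidAlgebra K (Equiv.Perm Ψ)] L, ∀ x, ψ (i x) = f x := by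
  let := coeffModule Ψ K V
  let := permAction Ψ K V
  let := coeffModule Ψ K X
  let := permAction Ψ K X
  let i' : X →ₗ[K] V :=
    { toFun := i
      map_add' := map_add i
      map_smul' := fun a x => map_smul i (coeffHom Ψ K a) x }
  let f' : X →ₗ[K] L :=
    { toFun := f
      map_add' := map_add f
      map_smul' := fun a x => by
        refine (map_smul f (coeffHom Ψ K a) x).trans ((hL 1 a (f x)).trans ?_)
        rw [one_smul, RingHom.id_apply, Algebra.smul_def] }
  obtain ⟨ψ, hψ, hψi⟩ := exists_extension_over hξ hKL hX.isSmoothSemilinear hV.isSmoothSemilinear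
    i' hi (fun g x => map_smul i (SkewMonoidAlgebra.of K (Equiv.Perm Ψ) g) x) f'
    (fun g x => (map_smul f (SkewMonoidAlgebra.of K (Equiv.Perm Ψ) g) x).trans
      ((hL g 1 (f x)).trans (by rw [map_one, one_mul]; rfl)))
  refine ⟨skewLinearMap ψ.toAddMonoidHom fun g a v => ?_, hψi⟩
  rw [single_smul_eq, hL]
  refine (ψ.map_smul a _).trans ?_
  rw [Algebra.smul_def]
  exact congrArg _ (hψ g v)

theorem exists_skew_ne_zero (hξ : IsSymGenerated ξ)
    (hKL : ∀ (g : Equiv.Perm Ψ) (a : K), g • algebraMap K L a = algebraMap K L (g • a))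
    (hL : ∀ (g : Equiv.Perm Ψ) (a : K) (m : L),
      SkewMonoidAlgebra.single g a • m = algebraMap K L a * (g • m))
    (hV : IsSmoothModule Ψ K V) {v : V} (hv : v ≠ 0) :
    ∃ ψ : V →ₗ[SkewMonoidAlgebra K (Equiv.Perm Ψ)] L, ψ v ≠ 0 := by
  let := coeffModule Ψ K V
  let := permAction Ψ K V
  obtain ⟨ψ, hψ, hψv⟩ := exists_ne_zero_over (L := L) hξ hKL hV.isSmoothSemilinear hv
  refine ⟨skewLinearMap ψ.toAddMonoidHom fun g a v => ?_, hψv⟩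
  rw [single_smul_eq, hL]
  refine (ψ.map_smul a _).trans ?_
  rw [Algebra.smul_def]
  exact congrArg _ (hψ g v)

theorem IsSmoothModule.submodule (hV : IsSmoothModule Ψ K V)
    (N : Submodule (SkewMonoidAlgebra K (Equiv.Perm Ψ)) V) : IsSmoothModule Ψ K N := fun v => by
  obtain ⟨T, hT⟩ := hV v
  exact ⟨T, fun g hg => Subtype.ext (hT g hg)⟩

theorem IsSmoothModule.quotient (hV : IsSmoothModule Ψ K V)
    (N : Submodule (SkewMonoidAlgebra K (Equiv.Perm Ψ)) V) : IsSmoothModule Ψ K (V ⧸ N) :=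
  fun v => by
  obtain ⟨v, rfl⟩ := N.mkQ_surjective v
  obtain ⟨T, hT⟩ := hV v
  exact ⟨T, fun g hg => by rw [← map_smul, hT g hg]⟩

end SkewModule

/-! ### Representations of finite length -/

section FiniteLength

variable {Ψ A L V : Type*} [Field L] [MulSemiringAction (Equiv.Perm Ψ) L] {ξ : Ψ → A → L}

/-- A nonzero functional is injective by simplicity and surjective because its image is a nonzero
`L`-subspace of `L`. -/
theorem nonempty_linearEquiv_of_isSimpleModule (hξ : IsSymGenerated ξ) [AddCommGroup V]
    [Module (SkewMonoidAlgebra L (Equiv.Perm Ψ)) V]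
    [IsSimpleModule (SkewMonoidAlgebra L (Equiv.Perm Ψ)) V] (hV : IsSmoothModule Ψ L V) :
    Nonempty (V ≃ₗ[SkewMonoidAlgebra L (Equiv.Perm Ψ)] L) := by
  have := IsSimpleModule.nontrivial (SkewMonoidAlgebra L (Equiv.Perm Ψ)) V
  obtain ⟨v, hv⟩ := exists_ne (0 : V)
  obtain ⟨ψ, hψ⟩ := exists_skew_ne_zero hξ (fun g a => rfl)
    (skewModuleSelf_single (Equiv.Perm Ψ) L) hV hv
  refine ⟨LinearEquiv.ofBijective ψ ⟨?_, fun a => ?_⟩⟩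
  · refine (LinearMap.injective_or_eq_zero ψ).resolve_right ?_
    rintro rfl
    exact hψ rfl
  · refine ⟨SkewMonoidAlgebra.single (1 : Equiv.Perm Ψ) (a / ψ v) • v, ?_⟩
    rw [map_smul, skewModuleSelf_single, one_smul, div_mul_cancel₀ _ hψ]

/-- A smooth semilinear representation of finite length is a sum of copies of the field. -/
theorem exists_linearEquiv_of_isFiniteLength (hξ : IsSymGenerated ξ) [AddCommGroup V]
    [Module (SkewMonoidAlgebra L (Equiv.Perm Ψ)) V] (hV : IsSmoothModule Ψ L V)
    (h : IsFiniteLength (SkewMonoidAlgebra L (Equiv.Perm Ψ)) V) :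
    ∃ n : ℕ, Nonempty (V ≃ₗ[SkewMonoidAlgebra L (Equiv.Perm Ψ)] (Fin n → L)) := by
  revert hV
  induction h with
  | @of_subsingleton M _ _ _ =>
    exact fun _ => ⟨0, ⟨LinearEquiv.ofSubsingleton _ _⟩⟩
  | @of_simple_quotient M _ _ N _ _ ih =>
    intro hV
    obtain ⟨n, ⟨e⟩⟩ := ih (hV.submodule N)
    obtain ⟨q⟩ := nonempty_linearEquiv_of_isSimpleModule hξ (hV.quotient N)
    have hext : ∀ j : Fin n, ∃ ψ : M →ₗ[SkewMonoidAlgebra L (Equiv.Perm Ψ)] L,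
        ∀ x : N, ψ x = e x j := fun j =>
      exists_skew_extension hξ (fun g a => rfl) (skewModuleSelf_single (Equiv.Perm Ψ) L)
        (hV.submodule N) hV N.subtype N.subtype_injective ((LinearMap.proj j).comp e.toLinearMap)
    choose ψ hψ using hext
    -- Coordinate 0 is the simple quotient; the others extend the coordinates of `N` by injectivity
    -- and so split the extension.
    let Φ : M →ₗ[SkewMonoidAlgebra L (Equiv.Perm Ψ)] (Fin (n + 1) → L) :=
      LinearMap.pi (Fin.cons (q.toLinearMap.comp N.mkQ) ψ)
    have h0 : ∀ x, Φ x 0 = q (N.mkQ x) := fun x => rfl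
    have hs : ∀ x (j : Fin n), Φ x j.succ = ψ j x := fun x j => rfl
    refine ⟨n + 1, ⟨LinearEquiv.ofBijective Φ ⟨?_, fun y => ?_⟩⟩⟩
    · rw [← LinearMap.ker_eq_bot, LinearMap.ker_eq_bot']
      intro x hx
      have hxN : x ∈ N := by
        have h1 := congrFun hx 0
        rw [h0] at h1
        rw [← Submodule.ker_mkQ N, LinearMap.mem_ker]
        exact (LinearEquiv.map_eq_zero_iff q).1 h1
      have h1 : e ⟨x, hxN⟩ = 0 := funext fun j => by
        have h2 := congrFun hx j.succ
        rw [hs] at h2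
        rw [← hψ]
        exact h2
      exact congrArg Subtype.val ((LinearEquiv.map_eq_zero_iff e).1 h1)
    · obtain ⟨x, hx⟩ := N.mkQ_surjective (q.symm (y 0))
      let z : N := e.symm fun j => y j.succ - ψ j x
      refine ⟨x + z, funext fun j => ?_⟩
      refine Fin.cases ?_ (fun j => ?_) j
      · have hz : N.mkQ (z : M) = 0 := by simp
        rw [h0, map_add, hz, add_zero, hx, LinearEquiv.apply_symm_apply]
      · rw [hs, map_add, hψ, LinearEquiv.apply_symm_apply, add_sub_cancel]

end FiniteLength

end

end SmSym

/-! ### The field F_Ψ and the categorical statements -/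

namespace SmSym

open CategoryTheory
open scoped TensorProduct Topology

noncomputable section

section FracPow

variable {F : Type v} [Field F] (k : Subfield F) (S : Type u)

/-- Project to two factors: a ⊗ 1 ≠ 1 ⊗ a, as x ⊗ y ↦ f(x) y shows for a linear form f with f(1) = 0
and f(a) ≠ 0. -/
theorem TensorPow.ι_injective_of_notMem {a : F} (ha : a ∉ k) :
    Function.Injective fun i : S => TensorPow.ι k i a := by
  classical
  intro i j hij
  by_contra hne
  have h1 := congrArg (TensorPow.lift k fun l : S =>
    if l = i then (Algebra.TensorProduct.includeLeft : F →ₐ[k] F ⊗[k] F)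
      else Algebra.TensorProduct.includeRight) hij
  simp only [TensorPow.lift_ι, if_true, if_neg (Ne.symm hne)] at h1
  have h2 : a ⊗ₜ[k] (1 : F) = (1 : F) ⊗ₜ[k] a := h1
  have hmem : a ∉ Submodule.span k {(1 : F)} := by
    rw [Submodule.mem_span_singleton]
    rintro ⟨c, rfl⟩
    exact ha (by simp [Subfield.smul_def])
  obtain ⟨f, hfa, hf⟩ := Submodule.exists_le_ker_of_notMem hmem
  have hf1 : f 1 = 0 := hf (Submodule.mem_span_singleton_self _)
  have h3 := congrArg (TensorProduct.lift ((LinearMap.lsmul k F).comp f)) h2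
  rw [TensorProduct.lift.tmul, TensorProduct.lift.tmul] at h3
  simp only [LinearMap.comp_apply, LinearMap.lsmul_apply, hf1, zero_smul, smul_eq_zero, one_ne_zero,
    or_false] at h3
  exact hfa h3

variable [IsDomain (TensorPow k S)]

theorem FracPow.isSymGenerated (hk : k ≠ ⊤) :
    IsSymGenerated fun (i : S) (a : F) =>
      algebraMap (TensorPow k S) (FracPow k S) (TensorPow.ι k i a) where
  smul g i a := by
    rw [FracPow.smul_algebraMap, TensorPow.smul_def, TensorPow.permHom_ι]
  closure_eq_top := by
    set ξ : S → F → FracPow k S := fun i a =>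
      algebraMap (TensorPow k S) (FracPow k S) (TensorPow.ι k i a)
    have key : ∀ x : TensorPow k S, algebraMap _ (FracPow k S) x ∈ subfieldOn ξ Set.univ := by
      intro x
      obtain ⟨p, rfl⟩ := TensorPow.proj_surjective k S x
      induction p using MvPolynomial.induction_on with
      | C c =>
        -- Constants enter as invariants, which covers empty `S`, where there are no labeled
        -- generators.
        refine Subfield.subset_closure (Or.inr fun g => ?_)
        rw [FracPow.smul_algebraMap, TensorPow.smul_def, ← MvPolynomial.algebraMap_eq,
          AlgHom.commutes, AlgHom.commutes]
      | add p q hp hq =>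
        rw [map_add, map_add]
        exact add_mem hp hq
      | mul_X p n hp =>
        rw [map_mul, map_mul]
        exact mul_mem hp (mem_subfieldOn (ξ := ξ) (Set.mem_univ n.1) n.2)
    refine eq_top_iff.2 fun x _ => ?_
    obtain ⟨a, b, -, rfl⟩ := IsFractionRing.div_surjective (A := TensorPow k S) x
    exact div_mem (key a) (key b)
  separated := by
    obtain ⟨a, ha⟩ : ∃ a, a ∉ k := by
      by_contra! h
      exact hk (eq_top_iff.2 fun a _ => h a)
    exact ⟨a, (IsFractionRing.injective (TensorPow k S) (FracPow k S)).comp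
      (TensorPow.ι_injective_of_notMem k S ha)⟩

end FracPow

section Smooth

variable {Ψ : Type u}

theorem exists_finset_of_isOpen {U : Set (Equiv.Perm Ψ)} (hU : IsOpen[permTopology Ψ] U)
    {g : Equiv.Perm Ψ} (hg : g ∈ U) :
    ∃ T : Finset Ψ, ∀ h : Equiv.Perm Ψ, (∀ i ∈ T, h i = g i) → h ∈ U := by
  classical
  have hU' : TopologicalSpace.GenerateOpen
    {U | ∃ x y : Ψ, U = {σ : Equiv.Perm Ψ | σ x = y}} U := hU
  clear hU
  induction hU' with
  | basic U hU =>
    obtain ⟨x, y, rfl⟩ := hU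
    exact ⟨{x}, fun h hh => (hh x (Finset.mem_singleton_self x)).trans hg⟩
  | univ => exact ⟨∅, fun _ _ => trivial⟩
  | inter U V _ _ ihU ihV =>
    obtain ⟨T, hT⟩ := ihU hg.1
    obtain ⟨T', hT'⟩ := ihV hg.2
    exact ⟨T ∪ T', fun h hh => ⟨hT h fun i hi => hh i (Finset.mem_union_left _ hi),
      hT' h fun i hi => hh i (Finset.mem_union_right _ hi)⟩⟩
  | sUnion 𝒰 _ ih =>
    obtain ⟨U, hU, hgU⟩ := hg
    obtain ⟨T, hT⟩ := ih U hU hgU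
    exact ⟨T, fun h hh => ⟨U, hU, hT h hh⟩⟩

variable {K : Type v} [Field K] [MulSemiringAction (Equiv.Perm Ψ) K]

theorem isSmoothRep_iff (V : ModuleCat.{w} (SkewMonoidAlgebra K (Equiv.Perm Ψ))) :
    IsSmoothRep K Ψ V ↔ IsSmoothModule Ψ K V := by
  constructor
  · intro h v
    have h1 : (1 : Equiv.Perm Ψ) ∈
        {σ : Equiv.Perm Ψ | SkewMonoidAlgebra.single σ (1 : K) • v = v} := one_smul _ v
    obtain ⟨T, hT⟩ := exists_finset_of_isOpen (h v) h1
    exact ⟨T, fun g hg => hT g hg⟩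
  · intro h v
    let := permAction Ψ K V
    obtain ⟨T, hT⟩ := h v
    exact isOpen_of_fix (MulAction.stabilizer (Equiv.Perm Ψ) v) T hT

/-- A subrepresentation of a smooth representation. -/
def Sm.ofSubmodule (V : Sm.{u, v, w} K Ψ)
    (N : Submodule (SkewMonoidAlgebra K (Equiv.Perm Ψ)) V.obj) : Sm.{u, v, w} K Ψ :=
  ⟨ModuleCat.of _ N, (isSmoothRep_iff _).2 (((isSmoothRep_iff _).1 V.property).submodule N)⟩

/-- The kernel is again smooth, so its inclusion and the zero map can be compared inside the
category. -/
theorem Sm.injective_of_mono {X Y : Sm.{u, v, w} K Ψ} (f : X ⟶ Y) [Mono f] :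
    Function.Injective f.hom.hom := by
  let N := LinearMap.ker f.hom.hom
  let i : Sm.ofSubmodule X N ⟶ X := ObjectProperty.homMk (ModuleCat.ofHom N.subtype)
  let z : Sm.ofSubmodule X N ⟶ X := ObjectProperty.homMk (ModuleCat.ofHom 0)
  have h : i ≫ f = z ≫ f := by
    refine ObjectProperty.hom_ext _ (ModuleCat.hom_ext (LinearMap.ext fun x => ?_))
    exact x.2.trans (map_zero f.hom.hom).symm
  have h1 : i = z := (cancel_mono f).1 h
  rw [← LinearMap.ker_eq_bot, LinearMap.ker_eq_bot']
  intro x hx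
  exact congrArg (fun j : Sm.ofSubmodule X N ⟶ X => j.hom.hom ⟨x, hx⟩) h1

end Smooth

section Main

variable {F : Type v} [Field F] {k : Subfield F} (Ψ : Type u)
  [IsDomain (TensorPow k Ψ)]

namespace FracPow

section Subfield

variable (K : Subfield (FracPow k Ψ)) [IsInvariantSubfield (Equiv.Perm Ψ) K]

theorem injective_obj (hk : k ≠ ⊤) : Injective (FracPow.obj k Ψ K) where
  factors {X Y} g f _ := by
    obtain ⟨ψ, hψ⟩ := exists_skew_extension (L := FracPow k Ψ) (FracPow.isSymGenerated k Ψ hk)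
      (fun g a => rfl) (skewModuleSubfield_single (Equiv.Perm Ψ) (FracPow k Ψ) K)
      ((isSmoothRep_iff _).1 X.property) ((isSmoothRep_iff _).1 Y.property) f.hom.hom
      (Sm.injective_of_mono f) g.hom.hom
    exact ⟨ObjectProperty.homMk (ModuleCat.ofHom ψ),
      ObjectProperty.hom_ext _ (ModuleCat.hom_ext (LinearMap.ext hψ))⟩

variable {K Ψ} in
theorem exists_linearMap_ne_zero (hk : k ≠ ⊤) (V : Sm.{u, max u v, w} K Ψ) {x : V.obj}
    (hx : x ≠ 0) :
    ∃ ψ : V.obj →ₗ[SkewMonoidAlgebra K (Equiv.Perm Ψ)] FracPow k Ψ, ψ x ≠ 0 :=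
  exists_skew_ne_zero (FracPow.isSymGenerated k Ψ hk) (fun _ _ => rfl)
    (skewModuleSubfield_single (Equiv.Perm Ψ) (FracPow k Ψ) K) ((isSmoothRep_iff _).1 V.property) hx

theorem isCoseparator_obj (hk : k ≠ ⊤) : IsCoseparator (FracPow.obj k Ψ K) := by
  rw [isCoseparator_def]
  intro X Y f g h
  refine ObjectProperty.hom_ext _ (ModuleCat.hom_ext (LinearMap.ext fun x => ?_))
  by_contra hne
  obtain ⟨ψ, hψ⟩ := exists_linearMap_ne_zero hk Y (sub_ne_zero.2 hne)
  let p : Y ⟶ FracPow.obj k Ψ K := ObjectProperty.homMk (ModuleCat.ofHom ψ)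
  have h1 : ψ (f.hom.hom x) = ψ (g.hom.hom x) :=
    congrArg (fun j : X ⟶ FracPow.obj k Ψ K => j.hom.hom x) (h p)
  rw [map_sub, h1, sub_self] at hψ
  exact hψ rfl

variable {K Ψ} in
theorem exists_injective_linearMap_pi (hk : k ≠ ⊤) (V : Sm.{u, max u v, max u v} K Ψ) :
    ∃ (I : Type (max u v)) (f : V.obj →ₗ[SkewMonoidAlgebra K (Equiv.Perm Ψ)] (I → FracPow k Ψ)),
      Function.Injective f := by
  refine ⟨V.obj →ₗ[SkewMonoidAlgebra K (Equiv.Perm Ψ)] FracPow k Ψ, LinearMap.pi fun ψ => ψ, ?_⟩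
  rw [← LinearMap.ker_eq_bot, LinearMap.ker_eq_bot']
  intro x hx
  by_contra hne
  obtain ⟨ψ, hψ⟩ := exists_linearMap_ne_zero hk V hne
  exact hψ (congrFun hx ψ)

end Subfield

theorem exists_linearEquiv_directSum (hk : k ≠ ⊤) (V : Sm.{u, max u v, w} (FracPow k Ψ) Ψ)
    (h : IsFiniteLength (SkewMonoidAlgebra (FracPow k Ψ) (Equiv.Perm Ψ)) V.obj) :
    ∃ n : ℕ, Nonempty (V.obj ≃ₗ[SkewMonoidAlgebra (FracPow k Ψ) (Equiv.Perm Ψ)]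
      DirectSum (Fin n) fun _ => FracPow k Ψ) := by
  obtain ⟨n, ⟨e⟩⟩ := exists_linearEquiv_of_isFiniteLength (FracPow.isSymGenerated k Ψ hk)
    ((isSmoothRep_iff _).1 V.property) h
  exact ⟨n, ⟨e.trans (DirectSum.linearEquivFunOnFintype _ (Fin n) _).symm⟩⟩

end FracPow

end Main

end

end SmSym

theorem mainTheorem2 {F : Type v} [Field F] (k : Subfield F) (hk : k ≠ ⊤)
    (hkF : ∀ x : F, IsAlgebraic k x → x ∈ k) (Ψ : Type u)
    -- the field of fractions of the tensor power has to make sense; automatic for perfect `k`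
    (hdom : PerfectField k ∨ IsDomain (SmSym.TensorPow k Ψ)) :
    ∃ _ : IsDomain (SmSym.TensorPow k Ψ),
      (∀ (K : Subfield (SmSym.FracPow k Ψ)) [IsInvariantSubfield (Equiv.Perm Ψ) K],
        CategoryTheory.Injective (SmSym.FracPow.obj k Ψ K) ∧
        CategoryTheory.IsCoseparator (SmSym.FracPow.obj k Ψ K) ∧
        -- every smooth `K`-semilinear representation embeds into a product of copies of `F_Ψ`
        ∀ V : SmSym.Sm.{u, max u v, max u v} K Ψ,
          ∃ (I : Type (max u v))
            (f : V.obj →ₗ[SkewMonoidAlgebra K (Equiv.Perm Ψ)] (I → SmSym.FracPow k Ψ)),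
            Function.Injective f) ∧
      -- every smooth `F_Ψ`-semilinear representation of finite length is a sum of copies of `F_Ψ`
      (∀ V : SmSym.Sm.{u, max u v, max u v} (SmSym.FracPow k Ψ) Ψ,
        IsFiniteLength (SkewMonoidAlgebra (SmSym.FracPow k Ψ) (Equiv.Perm Ψ)) V.obj →
          ∃ n : ℕ, Nonempty (V.obj ≃ₗ[SkewMonoidAlgebra (SmSym.FracPow k Ψ) (Equiv.Perm Ψ)]
            DirectSum (Fin n) fun _ => SmSym.FracPow k Ψ)) := by
  have hD : IsDomain (SmSym.TensorPow k Ψ) :=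
    hdom.elim (fun _ => SmSym.TensorPow.isDomain_of_perfectField hkF Ψ) id
  exact ⟨hD, fun K _ => ⟨SmSym.FracPow.injective_obj Ψ K hk, SmSym.FracPow.isCoseparator_obj Ψ K hk,
    fun V => SmSym.FracPow.exists_injective_linearMap_pi hk V⟩,
    fun V h => SmSym.FracPow.exists_linearEquiv_directSum Ψ hk V h⟩
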